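/- Let $m\ge 0$, $0<\alpha_m\le\dots\le\alpha_1<\alpha<1$, $b_1,\dots,b_m>0$ and $T>0$, and set $$P(\partial_t)=\partial_t^{\alpha}+\sum_{i=1}^m b_i\,\partial_t^{\alpha_i},\qquad \partial_t^\beta u(t)=\frac1{\Gamma(1-\beta)}\int_0^t(t-\tau)^{-\beta}u'(\tau)\,d\tau$$ (Caputo derivatives). Let $\Omega\subset\mathbb R^d$, $d\in\{1,2,3\}$, be a bounded convex polygonal domain, and let $\{\lambda_j\}_{j\ge1}$ and $\{\varphi_j\}_{j\ge1}$ be the eigenvalues (with multiplicity) and the $L^2(\Omega)$-orthonormal eigenfunctions of $-\Delta$ on $\Omega$ with homogeneous Dirichlet boundary condition. For real $s$ and $v\in H^{-1}(\Omega)$ put $$\|v\|_{\dot H^s}^2=\sum_{j=1}^\infty\lambda_j^s\langle v,\varphi_j\rangle^2,\qquad \dot H^s=\{v\in H^{-1}(\Omega):\|v\|_{\dot H^s}<\infty\}.$$ For $\vec\beta=(\beta_1,\dots,\beta_n)$ let $$E_{\vec\beta,\beta_0}(z_1,\dots,z_n)=\sum_{k=0}^\infty\ \sum_{l_1+\dots+l_n=k}\frac{k!}{l_1!\cdots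 l_n!}\,\frac{\prod_{i=1}^n z_i^{l_i}}{\Gamma(\beta_0+\sum_{i=1}^n\beta_il_i)}$$ be the multinomial Mittag-Leffler function and, with $\vec\alpha=(\alpha,\alpha-\alpha_1,\dots,\alpha-\alpha_m)$, define $$E(t)v=\sum_{j=1}^\infty\Big(1-\lambda_jt^\alpha E_{\vec\alpha,1+\alpha}(-\lambda_jt^\alpha,-b_1t^{\alpha-\alpha_1},\dots,-b_mt^{\alpha-\alpha_m})\Big)\langle v,\varphi_j\rangle\varphi_j .$$ Then there is a constant $C>0$, depending only on $\alpha,\alpha_1,\dots,\alpha_m,b_1,\dots,b_m$ and $T$, such that for every $q\in(-1,2]$ and $v\in\dot H^q$ the following holds. For $0<t\le T$ the series for $u(t)=E(t)v$ converges in $H^{-1}(\Omega)$; $u(t)\in H^1_0(\Omega)$; the Caputo derivatives of orders $\alpha,\alpha_1,\dots,\alpha_m$ of $u$ exist at $t$ as Bochner integrals in $H^{-1}(\Omega)$; and $P(\partial_t)u(t)-\Delta u(t)=0$ in $H^{-1}(\Omega)$. Moreover $P(\partial_t)^\ell u(t)\in\dot H^p$ and $$\|P(\partial_t)^\ell u(t)\|_{\dot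 H^p}\le C\,t^{-\alpha(\ell+(p-q)/2)}\,\|v\|_{\dot H^q},\qquad 0<t\le T,$$ for $\ell=0$ and all real $p$ with $0\le p-q\le2$, and for $\ell=1$ and all real $p$ with $-2\le p-q\le0$. Finally, the initial condition holds in the sense that $u(t)-v\in\dot H^q$ for $0<t\le T$ and $\lim_{t\to0^+}\|u(t)-v\|_{\dot H^q}=0$. -/

import Mathlib

open MeasureTheory Filter Topology Set
open scoped ContDiff RealInnerProductSpace

noncomputable section

namespace MultiTermDiffusion

/-! ### Domains and the spaces `H¹₀(Ω)`, `H⁻¹(Ω)` -/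

/-- A bounded convex polygonal (polyhedral) domain: the nonempty interior of the convex hull of
finitely many points. -/
def IsConvexPolygonalDomain {d : ℕ} (Ω : Set (EuclideanSpace ℝ (Fin d))) : Prop :=
  Ω.Nonempty ∧
    ∃ S : Set (EuclideanSpace ℝ (Fin d)), S.Finite ∧ Ω = interior (convexHull ℝ S)

/-- `L²(Ω)`. -/
abbrev L2 {d : ℕ} (Ω : Set (EuclideanSpace ℝ (Fin d))) : Type :=
  Lp ℝ 2 (volume.restrict Ω)

/-- `L²(Ω; ℝᵈ)`. -/
abbrev L2Vec {d : ℕ} (Ω : Set (EuclideanSpace ℝ (Fin d))) : Type :=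
  Lp (EuclideanSpace ℝ (Fin d)) 2 (volume.restrict Ω)

/-- The pairs `(ψ, ∇ψ)` in `L²(Ω) × L²(Ω; ℝᵈ)` with `ψ ∈ C_c^∞(Ω)`. -/
def testGraph {d : ℕ} (Ω : Set (EuclideanSpace ℝ (Fin d))) :
    Set (WithLp 2 (L2 Ω × L2Vec Ω)) :=
  {w | ∃ ψ : EuclideanSpace ℝ (Fin d) → ℝ,
    ContDiff ℝ ∞ ψ ∧ HasCompactSupport ψ ∧ tsupport ψ ⊆ Ω ∧
    (w.fst : EuclideanSpace ℝ (Fin d) → ℝ) =ᵐ[volume.restrict Ω] ψ ∧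
    (w.snd : EuclideanSpace ℝ (Fin d) → EuclideanSpace ℝ (Fin d))
      =ᵐ[volume.restrict Ω] gradient ψ}

/-- `H¹₀(Ω)`, the closure of `C_c^∞(Ω)` in the norm `(‖ψ‖² + ‖∇ψ‖²)^{1/2}`; an element is
recorded together with its weak gradient. -/
abbrev H10 {d : ℕ} (Ω : Set (EuclideanSpace ℝ (Fin d))) :
    Submodule ℝ (WithLp 2 (L2 Ω × L2Vec Ω)) :=
  (Submodule.span ℝ (testGraph Ω)).topologicalClosure

/-- The inclusion `H¹₀(Ω) → L²(Ω)`. -/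
def toL2 {d : ℕ} (Ω : Set (EuclideanSpace ℝ (Fin d))) : H10 Ω →L[ℝ] L2 Ω :=
  (WithLp.fstL 2 ℝ (L2 Ω) (L2Vec Ω)).comp (H10 Ω).subtypeL

/-- The weak gradient `H¹₀(Ω) → L²(Ω; ℝᵈ)`. -/
def grad {d : ℕ} (Ω : Set (EuclideanSpace ℝ (Fin d))) : H10 Ω →L[ℝ] L2Vec Ω :=
  (WithLp.sndL 2 ℝ (L2 Ω) (L2Vec Ω)).comp (H10 Ω).subtypeL

/-- `H⁻¹(Ω)`, the dual of `H¹₀(Ω)`. -/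
abbrev HNegOne {d : ℕ} (Ω : Set (EuclideanSpace ℝ (Fin d))) : Type :=
  StrongDual ℝ (H10 Ω)

/-- The embedding `H¹₀(Ω) ⊂ L²(Ω) ⊂ H⁻¹(Ω)`, `⟨w, χ⟩ = (w, χ)_{L²}`. -/
def embed {d : ℕ} {Ω : Set (EuclideanSpace ℝ (Fin d))} (w : H10 Ω) : HNegOne Ω :=
  (innerSL ℝ (toL2 Ω w)).comp (toL2 Ω)

/-- The weak Dirichlet Laplacian `Δ : H¹₀(Ω) → H⁻¹(Ω)`, `⟨Δw, χ⟩ = -(∇w, ∇χ)_{L²}`. -/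
def laplacian {d : ℕ} {Ω : Set (EuclideanSpace ℝ (Fin d))} (w : H10 Ω) : HNegOne Ω :=
  -(innerSL ℝ (grad Ω w)).comp (grad Ω)

/-! ### Dirichlet eigenfunctions and the spaces `Ḣˢ(Ω)` -/

/-- `-Δw = μ w` weakly, with zero Dirichlet boundary condition. -/
def IsDirichletEigenpair {d : ℕ} {Ω : Set (EuclideanSpace ℝ (Fin d))}
    (μ : ℝ) (w : H10 Ω) : Prop :=
  w ≠ 0 ∧ -laplacian w = μ • embed w

/-- `(lam j)` are the eigenvalues of the Dirichlet Laplacian `-Δ`, counted with multiplicity, and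
`(φ j)` are corresponding `L²(Ω)`-orthonormal eigenfunctions; `exhaustive` says that no
eigenfunction has been left out. -/
structure IsDirichletEigensystem {d : ℕ} (Ω : Set (EuclideanSpace ℝ (Fin d)))
    (lam : ℕ → ℝ) (φ : ℕ → H10 Ω) : Prop where
  orthonormal : Orthonormal ℝ (fun j => toL2 Ω (φ j))
  eigenpair : ∀ j, IsDirichletEigenpair (lam j) (φ j)
  exhaustive : ∀ (μ : ℝ) (w : H10 Ω), IsDirichletEigenpair μ w →
    ∃ j, ⟪toL2 Ω (φ j), toL2 Ω w⟫ ≠ 0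

/-- `v ∈ Ḣˢ(Ω)`: the element `v` of `H⁻¹(Ω)` satisfies `∑ⱼ λⱼˢ ⟨v, φⱼ⟩² < ∞`. -/
def MemDotH {d : ℕ} {Ω : Set (EuclideanSpace ℝ (Fin d))} (lam : ℕ → ℝ) (φ : ℕ → H10 Ω)
    (s : ℝ) (v : HNegOne Ω) : Prop :=
  Summable fun j => lam j ^ s * (v (φ j)) ^ 2

/-- The norm `‖v‖ = (∑ⱼ λⱼˢ ⟨v, φⱼ⟩²)^{1/2}` of `Ḣˢ(Ω)`. -/
def dotHNorm {d : ℕ} {Ω : Set (EuclideanSpace ℝ (Fin d))} (lam : ℕ → ℝ) (φ : ℕ → H10 Ω)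
    (s : ℝ) (v : HNegOne Ω) : ℝ :=
  Real.sqrt (∑' j, lam j ^ s * (v (φ j)) ^ 2)

/-! ### Multinomial Mittag-Leffler function and solution operator -/

/-- The multinomial Mittag-Leffler function `E_{(β₁,…,βₙ),β₀}(z₁,…,zₙ)` at real arguments. -/
def multinomialML {n : ℕ} (β : Fin n → ℝ) (β₀ : ℝ) (z : Fin n → ℝ) : ℝ :=
  ∑' k : ℕ, ∑ l ∈ Finset.piAntidiag (Finset.univ : Finset (Fin n)) k,
    (Nat.multinomial Finset.univ l : ℝ) * (∏ i, z i ^ l i) / Real.Gamma (β₀ + ∑ i, β i * l i)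

/-- The factor
`1 - λ t^α E_{(α,α-α₁,…,α-αₘ),1+α}(-λ t^α, -b₁ t^{α-α₁}, …, -bₘ t^{α-αₘ})`. -/
def modeFactor {m : ℕ} (α : ℝ) (αs b : Fin m → ℝ) (lam t : ℝ) : ℝ :=
  1 - lam * t ^ α *
    multinomialML (Fin.cons α (fun i => α - αs i) : Fin (m + 1) → ℝ) (1 + α)
      (Fin.cons (-(lam * t ^ α)) (fun i => -(b i * t ^ (α - αs i))) : Fin (m + 1) → ℝ)

/-- The `j`-th term of the series defining `E(t)v`. -/
def solTerm {d : ℕ} {Ω : Set (EuclideanSpace ℝ (Fin d))} {m : ℕ} (α : ℝ) (αs b : Fin m → ℝ)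
    (lam : ℕ → ℝ) (φ : ℕ → H10 Ω) (v : HNegOne Ω) (t : ℝ) (j : ℕ) : HNegOne Ω :=
  (modeFactor α αs b (lam j) t * v (φ j)) • embed (φ j)

/-- The solution operator `E(t)v`, the series being summed in `H⁻¹(Ω)`. -/
def solOp {d : ℕ} {Ω : Set (EuclideanSpace ℝ (Fin d))} {m : ℕ} (α : ℝ) (αs b : Fin m → ℝ)
    (lam : ℕ → ℝ) (φ : ℕ → H10 Ω) (v : HNegOne Ω) (t : ℝ) : HNegOne Ω :=
  ∑' j, solTerm α αs b lam φ v t j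

/-! ### Caputo derivatives of vector-valued functions -/

/-- The integral that defines the Caputo derivative of order `β` of `u` at `t` makes sense. -/
def CaputoDifferentiableAt {F : Type*} [NormedAddCommGroup F] [NormedSpace ℝ F]
    (β : ℝ) (u : ℝ → F) (t : ℝ) : Prop :=
  (∀ τ ∈ Ioo 0 t, DifferentiableAt ℝ u τ) ∧
    IntervalIntegrable (fun τ => (t - τ) ^ (-β) • deriv u τ) volume 0 t

/-- The left-sided Caputo derivative `Γ(1-β)⁻¹ ∫₀ᵗ (t-τ)^{-β} u'(τ) dτ`. -/
def caputoDeriv {F : Type*} [NormedAddCommGroup F] [NormedSpace ℝ F]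
    (β : ℝ) (u : ℝ → F) (t : ℝ) : F :=
  (Real.Gamma (1 - β))⁻¹ • ∫ τ in (0 : ℝ)..t, (t - τ) ^ (-β) • deriv u τ

/-- `P(∂ₜ)u = ∂ₜ^α u + ∑ᵢ bᵢ ∂ₜ^{αᵢ} u`. -/
def multiTermDeriv {F : Type*} [NormedAddCommGroup F] [NormedSpace ℝ F] {m : ℕ}
    (α : ℝ) (αs b : Fin m → ℝ) (u : ℝ → F) (t : ℝ) : F :=
  caputoDeriv α u t + ∑ i, b i • caputoDeriv (αs i) u t

/-- On `(0, T]` the function `u` satisfies `P(∂ₜ)u - Δu = 0` in `H⁻¹(Ω)` with `u(t) ∈ H¹₀(Ω)`, all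
the Caputo derivatives existing. -/
def SolvesHomogeneous {d : ℕ} {Ω : Set (EuclideanSpace ℝ (Fin d))} {m : ℕ}
    (α : ℝ) (αs b : Fin m → ℝ) (T : ℝ) (u : ℝ → HNegOne Ω) : Prop :=
  ∀ t ∈ Ioc 0 T,
    CaputoDifferentiableAt α u t ∧ (∀ i, CaputoDifferentiableAt (αs i) u t) ∧
    ∃ w : H10 Ω, embed w = u t ∧ multiTermDeriv α αs b u t - laplacian w = 0

end MultiTermDiffusion

end

/-!
In the eigenbasis the problem decouples into the scalar equations `P(∂ₜ)y + λy = 0`, `y(0) = 1`,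
solved by `modeFactor`. The operator `P(∂ₜ) + λ` obeys a maximum principle, since a Caputo
derivative of a function at its maximum is nonnegative. Applied to `y` and to `t y'` it gives
`0 ≤ y ≤ 1` and bounds of `λ^θ t^{αθ} y` and of `λ^{-θ} t^{1-αθ} |y'|` for `0 ≤ θ ≤ 1`, uniformly
in `λ > 0`. To return to `H⁻¹(Ω)`, normalize the eigenfunctions in `H¹₀(Ω)`, whose Riesz map is
`1 - Δ`: they form an orthonormal system, its dual functionals span an isometric copy of `ℓ²` in
`H⁻¹(Ω)`, and everything reduces to the calculus of curves in `ℓ²` whose coordinates are dominated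
by one square summable sequence.
-/

namespace MultiTermDiffusion

/-! ### Caputo derivatives -/

section Caputo

variable {F G : Type*} [NormedAddCommGroup F] [NormedSpace ℝ F] [NormedAddCommGroup G]
  [NormedSpace ℝ G] {u w : ℝ → F} {β t : ℝ}

theorem caputoDeriv_congr (ht : 0 ≤ t) (h : EqOn u w (Ioo 0 t)) :
    caputoDeriv β u t = caputoDeriv β w t := by
  rw [caputoDeriv, caputoDeriv, intervalIntegral.integral_congr_Ioo_of_le ht fun τ hτ => ?_]
  rw [(h.eventuallyEq_of_mem (isOpen_Ioo.mem_nhds hτ)).deriv_eq]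

theorem CaputoDifferentiableAt.congr (hu : CaputoDifferentiableAt β u t) (ht : 0 ≤ t)
    (h : EqOn u w (Ioo 0 t)) : CaputoDifferentiableAt β w t := by
  have heq : ∀ τ ∈ Ioo 0 t, u =ᶠ[𝓝 τ] w := fun τ hτ =>
    h.eventuallyEq_of_mem (isOpen_Ioo.mem_nhds hτ)
  refine ⟨fun τ hτ => (heq τ hτ).differentiableAt_iff.1 (hu.1 τ hτ), hu.2.congr_uIoo ?_⟩
  rw [uIoo_of_le ht]
  exact fun τ hτ => by simp only [(heq τ hτ).deriv_eq]

theorem CaputoDifferentiableAt.add (hu : CaputoDifferentiableAt β u t)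
    (hw : CaputoDifferentiableAt β w t) (ht : 0 ≤ t) :
    CaputoDifferentiableAt β (fun τ => u τ + w τ) t := by
  refine ⟨fun τ hτ => (hu.1 τ hτ).add (hw.1 τ hτ), (hu.2.add hw.2).congr_uIoo ?_⟩
  rw [uIoo_of_le ht]
  intro τ hτ
  simp only [deriv_fun_add (hu.1 τ hτ) (hw.1 τ hτ), smul_add]

theorem caputoDeriv_add (hu : CaputoDifferentiableAt β u t) (hw : CaputoDifferentiableAt β w t)
    (ht : 0 ≤ t) :
    caputoDeriv β (fun τ => u τ + w τ) t = caputoDeriv β u t + caputoDeriv β w t := by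
  rw [caputoDeriv, caputoDeriv, caputoDeriv, ← smul_add, ← intervalIntegral.integral_add hu.2 hw.2,
    intervalIntegral.integral_congr_Ioo_of_le ht fun τ hτ => ?_]
  rw [deriv_fun_add (hu.1 τ hτ) (hw.1 τ hτ), smul_add]

theorem CaputoDifferentiableAt.const_smul (hu : CaputoDifferentiableAt β u t) (c : ℝ) :
    CaputoDifferentiableAt β (fun τ => c • u τ) t := by
  refine ⟨fun τ hτ => (hu.1 τ hτ).const_smul c, (hu.2.smul c).congr fun τ _ => ?_⟩
  simp only [Pi.smul_apply, deriv_fun_const_smul_field, smul_comm c]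

theorem caputoDeriv_const_smul (c : ℝ) :
    caputoDeriv β (fun τ => c • u τ) t = c • caputoDeriv β u t := by
  simp only [caputoDeriv, deriv_fun_const_smul_field, smul_comm _ c, intervalIntegral.integral_smul]

theorem caputoDeriv_const (c : F) : caputoDeriv β (fun _ => c) t = 0 := by
  simp [caputoDeriv]

theorem CaputoDifferentiableAt.clm_comp (hu : CaputoDifferentiableAt β u t) (L : F →L[ℝ] G)
    (ht : 0 ≤ t) : CaputoDifferentiableAt β (fun τ => L (u τ)) t := by
  refine ⟨fun τ hτ => L.differentiableAt.comp τ (hu.1 τ hτ), ?_⟩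
  refine (show IntervalIntegrable _ volume 0 t from
    ⟨L.integrable_comp hu.2.1, L.integrable_comp hu.2.2⟩).congr_uIoo ?_
  rw [uIoo_of_le ht]
  intro τ hτ
  simp only [map_smul, ← (L.hasFDerivAt.comp_hasDerivAt τ (hu.1 τ hτ).hasDerivAt).deriv,
    Function.comp_def]

theorem caputoDeriv_clm_comp [CompleteSpace F] [CompleteSpace G]
    (hu : CaputoDifferentiableAt β u t) (L : F →L[ℝ] G) (ht : 0 ≤ t) :
    caputoDeriv β (fun τ => L (u τ)) t = L (caputoDeriv β u t) := by
  rw [caputoDeriv, caputoDeriv, map_smul, ← L.intervalIntegral_comp_comm hu.2,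
    intervalIntegral.integral_congr_Ioo_of_le ht fun τ hτ => ?_]
  simp only [map_smul, ← (L.hasFDerivAt.comp_hasDerivAt τ (hu.1 τ hτ).hasDerivAt).deriv,
    Function.comp_def]

theorem caputoDeriv_nonpos {f : ℝ → ℝ} (hβ : β < 1) (ht : 0 ≤ t)
    (hf : ∀ τ ∈ Ioo 0 t, deriv f τ ≤ 0) : caputoDeriv β f t ≤ 0 := by
  refine smul_nonpos_of_nonneg_of_nonpos
    (inv_nonneg.2 (Real.Gamma_pos_of_pos (sub_pos.2 hβ)).le) ?_
  rw [intervalIntegral.integral_of_le ht, integral_Ioc_eq_integral_Ioo]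
  exact setIntegral_nonpos measurableSet_Ioo fun τ hτ => mul_nonpos_of_nonneg_of_nonpos
    (Real.rpow_nonneg (sub_nonneg.2 hτ.2.le) _) (hf τ hτ)

theorem caputoDeriv_neg_of_deriv_neg {f : ℝ → ℝ} (hβ : β < 1) (ht : 0 < t)
    (hf : CaputoDifferentiableAt β f t) (hneg : ∀ τ ∈ Ioo 0 t, deriv f τ < 0) :
    caputoDeriv β f t < 0 := by
  refine smul_neg_of_pos_of_neg (inv_pos.2 (Real.Gamma_pos_of_pos (sub_pos.2 hβ))) ?_
  rw [← neg_pos, ← intervalIntegral.integral_neg]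
  exact intervalIntegral.intervalIntegral_pos_of_pos_on hf.2.neg (fun τ hτ => neg_pos.2 <|
    mul_neg_of_pos_of_neg (Real.rpow_pos_of_pos (sub_pos.2 hτ.2) _) (hneg τ hτ)) ht

section MultiTerm

variable {m : ℕ} {α : ℝ} {αs b : Fin m → ℝ}

theorem multiTermDeriv_congr (ht : 0 ≤ t) (h : EqOn u w (Ioo 0 t)) :
    multiTermDeriv α αs b u t = multiTermDeriv α αs b w t := by
  simp only [multiTermDeriv, caputoDeriv_congr ht h]

theorem multiTermDeriv_add (hu : CaputoDifferentiableAt α u t)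
    (hus : ∀ i, CaputoDifferentiableAt (αs i) u t) (hw : CaputoDifferentiableAt α w t)
    (hws : ∀ i, CaputoDifferentiableAt (αs i) w t) (ht : 0 ≤ t) :
    multiTermDeriv α αs b (fun τ => u τ + w τ) t
      = multiTermDeriv α αs b u t + multiTermDeriv α αs b w t := by
  simp only [multiTermDeriv, caputoDeriv_add hu hw ht, fun i => caputoDeriv_add (hus i) (hws i) ht,
    smul_add, Finset.sum_add_distrib]
  abel

theorem multiTermDeriv_const_smul (c : ℝ) :
    multiTermDeriv α αs b (fun τ => c • u τ) t = c • multiTermDeriv α αs b u t := by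
  simp only [multiTermDeriv, caputoDeriv_const_smul, smul_add, Finset.smul_sum, smul_comm c]

theorem multiTermDeriv_const (c : F) : multiTermDeriv α αs b (fun _ => c) t = 0 := by
  simp [multiTermDeriv, caputoDeriv_const]

theorem multiTermDeriv_clm_comp [CompleteSpace F] [CompleteSpace G]
    (hu : CaputoDifferentiableAt α u t) (hus : ∀ i, CaputoDifferentiableAt (αs i) u t)
    (L : F →L[ℝ] G) (ht : 0 ≤ t) :
    multiTermDeriv α αs b (fun τ => L (u τ)) t = L (multiTermDeriv α αs b u t) := by
  simp only [multiTermDeriv, caputoDeriv_clm_comp hu L ht,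
    fun i => caputoDeriv_clm_comp (hus i) L ht, map_add, map_sum, map_smul]

end MultiTerm

end Caputo

/-- Continuity on `[0, ∞)` together with the existence of all Caputo derivatives of order below
`1`; the class of functions to which the maximum principle for `P(∂ₜ) + λ` applies. -/
structure CaputoRegular (f : ℝ → ℝ) : Prop where
  continuousOn : ContinuousOn f (Ici 0)
  caputoDifferentiableAt : ∀ β < 1, ∀ t > 0, CaputoDifferentiableAt β f t

namespace CaputoRegular

variable {f g : ℝ → ℝ}

theorem differentiableAt (hf : CaputoRegular f) {t : ℝ} (ht : 0 < t) : DifferentiableAt ℝ f t :=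
  (hf.caputoDifferentiableAt 0 one_pos (t + 1) (by linarith)).1 t ⟨ht, lt_add_one t⟩

theorem congr (hf : CaputoRegular f) (h : EqOn f g (Ici 0)) : CaputoRegular g where
  continuousOn := hf.continuousOn.congr h.symm
  caputoDifferentiableAt β hβ t ht := (hf.caputoDifferentiableAt β hβ t ht).congr ht.le
    (h.mono fun _ hτ => hτ.1.le)

theorem add (hf : CaputoRegular f) (hg : CaputoRegular g) : CaputoRegular fun t => f t + g t where
  continuousOn := hf.continuousOn.add hg.continuousOn
  caputoDifferentiableAt β hβ t ht :=
    (hf.caputoDifferentiableAt β hβ t ht).add (hg.caputoDifferentiableAt β hβ t ht) ht.le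

theorem const_mul (hf : CaputoRegular f) (c : ℝ) : CaputoRegular fun t => c * f t where
  continuousOn := continuousOn_const.mul hf.continuousOn
  caputoDifferentiableAt β hβ t ht := (hf.caputoDifferentiableAt β hβ t ht).const_smul c

end CaputoRegular

theorem caputoRegular_const (c : ℝ) : CaputoRegular fun _ => c where
  continuousOn := continuousOn_const
  caputoDifferentiableAt β _ t _ := ⟨fun _ _ => differentiableAt_const c, by simp⟩

/-! ### The maximum principle for `P(∂ₜ) + λ` -/

/-- The standing assumptions `0 < αᵢ < α < 1` and `bᵢ > 0` on the orders and weights of `P(∂ₜ)`. -/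
structure AdmissibleOrders {m : ℕ} (α : ℝ) (αs b : Fin m → ℝ) : Prop where
  pos : 0 < α
  lt_one : α < 1
  lower_pos : ∀ i, 0 < αs i
  lower_lt : ∀ i, αs i < α
  weight_pos : ∀ i, 0 < b i

theorem AdmissibleOrders.lower_lt_one {m : ℕ} {α : ℝ} {αs b : Fin m → ℝ}
    (hP : AdmissibleOrders α αs b) (i : Fin m) : αs i < 1 :=
  (hP.lower_lt i).trans hP.lt_one

theorem tendsto_sub_rpow_neg_mul_sub {f : ℝ → ℝ} {β t : ℝ} (hβ : β < 1)
    (hf : DifferentiableAt ℝ f t) :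
    Tendsto (fun τ => (t - τ) ^ (-β) * (f τ - f t)) (𝓝[≤] t) (𝓝 0) := by
  have hO : (fun τ => (t - τ) ^ (-β) * (f τ - f t)) =O[𝓝[≤] t] fun τ => (t - τ) ^ (1 - β) := by
    have hsub : (fun τ => f τ - f t) =O[𝓝[≤] t] fun τ => t - τ :=
      (hf.isBigO_sub.mono nhdsWithin_le_nhds).trans
        (Asymptotics.isBigO_of_le _ fun τ => (norm_sub_rev τ t).le)
    refine ((Asymptotics.isBigO_refl (fun τ : ℝ => (t - τ) ^ (-β)) _).mul hsub).congr'
      EventuallyEq.rfl ?_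
    filter_upwards [self_mem_nhdsWithin] with τ (hτ : τ ≤ t)
    rcases hτ.lt_or_eq with h | rfl
    · rw [← Real.rpow_add_one (sub_pos.2 h).ne', neg_add_eq_sub]
    · simp [Real.zero_rpow (sub_pos.2 hβ).ne']
  have hlim : ContinuousAt (fun τ : ℝ => (t - τ) ^ (1 - β)) t :=
    ContinuousAt.rpow_const (by fun_prop) (Or.inr (sub_pos.2 hβ).le)
  have hzero : (t - t) ^ (1 - β) = 0 := by rw [sub_self, Real.zero_rpow (sub_pos.2 hβ).ne']
  exact hO.trans_tendsto (hzero ▸ hlim.tendsto.mono_left nhdsWithin_le_nhds)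

theorem continuousOn_sub_rpow_neg_mul_sub {f : ℝ → ℝ} {β a t : ℝ} (hβ : β < 1)
    (hc : ContinuousOn f (Icc a t)) (hf : DifferentiableAt ℝ f t) :
    ContinuousOn (fun τ => (t - τ) ^ (-β) * (f τ - f t)) (Icc a t) := by
  intro τ hτ
  rcases hτ.2.lt_or_eq with h | rfl
  · exact (ContinuousWithinAt.rpow_const (by fun_prop) (Or.inl (sub_pos.2 h).ne')).mul
      ((hc τ hτ).sub continuousWithinAt_const)
  · rw [ContinuousWithinAt, sub_self (f τ), mul_zero]
    exact (tendsto_sub_rpow_neg_mul_sub hβ hf).mono_left (nhdsWithin_mono _ Icc_subset_Iic_self)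

/-- Luchko's extremum principle. By parts, `Γ(1-β) ∂^β f(t)` is the sum of the boundary term
`t^{-β} (f t - f 0)` and of `β ∫₀ᵗ (t-τ)^{-β-1} (f t - f τ) dτ`. -/
theorem caputoDeriv_nonneg_of_max {f : ℝ → ℝ} {β t : ℝ} (hβ₀ : 0 ≤ β) (hβ₁ : β < 1) (ht : 0 < t)
    (hc : ContinuousOn f (Icc 0 t)) (hf : DifferentiableAt ℝ f t)
    (hfβ : CaputoDifferentiableAt β f t) (hmax : ∀ τ ∈ Icc 0 t, f τ ≤ f t) :
    0 ≤ caputoDeriv β f t := by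
  refine smul_nonneg (inv_nonneg.2 (Real.Gamma_pos_of_pos (sub_pos.2 hβ₁)).le) ?_
  have hderiv : ∀ τ ∈ Ioo 0 t, HasDerivAt (fun τ => (t - τ) ^ (-β) * (f τ - f t))
      (β * (t - τ) ^ (-β - 1) * (f τ - f t) + (t - τ) ^ (-β) * deriv f τ) τ := fun τ hτ => by
    have hk := ((hasDerivAt_id τ).const_sub t).rpow_const (p := -β) (Or.inl (sub_pos.2 hτ.2).ne')
    refine (hk.mul ((hfβ.1 τ hτ).hasDerivAt.sub_const (f t))).congr_deriv ?_
    simp only [id]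
    ring
  have hbound := intervalIntegral.sub_le_integral_of_hasDeriv_right_of_le ht.le
    (continuousOn_sub_rpow_neg_mul_sub hβ₁ hc hf) (fun τ hτ => (hderiv τ hτ).hasDerivWithinAt)
    (φ := fun τ => (t - τ) ^ (-β) • deriv f τ)
    ((intervalIntegrable_iff_integrableOn_Icc_of_le ht.le).1 hfβ.2) fun τ hτ => by
      refine add_le_of_nonpos_left (mul_nonpos_of_nonneg_of_nonpos ?_ ?_)
      · exact mul_nonneg hβ₀ (Real.rpow_nonneg (sub_nonneg.2 hτ.2.le) _)
      · exact sub_nonpos.2 (hmax τ ⟨hτ.1.le, hτ.2.le⟩)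
  refine le_trans ?_ hbound
  rw [sub_self (f t), mul_zero, zero_sub, sub_zero, ← mul_neg, neg_sub]
  exact mul_nonneg (Real.rpow_nonneg ht.le _) (sub_nonneg.2 (hmax 0 ⟨le_rfl, ht.le⟩))

namespace CaputoRegular

variable {m : ℕ} {α : ℝ} {αs b : Fin m → ℝ} {f g : ℝ → ℝ}

theorem multiTermDeriv_add (hf : CaputoRegular f) (hg : CaputoRegular g)
    (hα : α < 1) (hαs : ∀ i, αs i < 1) {t : ℝ} (ht : 0 < t) :
    multiTermDeriv α αs b (fun t => f t + g t) t
      = multiTermDeriv α αs b f t + multiTermDeriv α αs b g t :=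
  MultiTermDiffusion.multiTermDeriv_add (hf.caputoDifferentiableAt α hα t ht)
    (fun i => hf.caputoDifferentiableAt (αs i) (hαs i) t ht) (hg.caputoDifferentiableAt α hα t ht)
    (fun i => hg.caputoDifferentiableAt (αs i) (hαs i) t ht) ht.le

theorem multiTermDeriv_nonneg_of_max (hP : AdmissibleOrders α αs b) (hf : CaputoRegular f) {t : ℝ}
    (ht : 0 < t) (hmax : ∀ τ ∈ Icc 0 t, f τ ≤ f t) : 0 ≤ multiTermDeriv α αs b f t := by
  have hcaputo : ∀ β, 0 < β → β < 1 → 0 ≤ caputoDeriv β f t := fun β h₀ h₁ =>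
    caputoDeriv_nonneg_of_max h₀.le h₁ ht (hf.continuousOn.mono Icc_subset_Ici_self)
      (hf.differentiableAt ht) (hf.caputoDifferentiableAt β h₁ t ht) hmax
  exact add_nonneg (hcaputo α hP.pos hP.lt_one) (Finset.sum_nonneg fun i _ =>
    smul_nonneg (hP.weight_pos i).le (hcaputo _ (hP.lower_pos i) (hP.lower_lt_one i)))

theorem nonneg_of_multiTermDeriv_add_nonneg (hP : AdmissibleOrders α αs b) (hf : CaputoRegular f)
    {lam : ℝ} (hlam : 0 < lam) (h₀ : 0 ≤ f 0)
    (h : ∀ t, 0 < t → 0 ≤ multiTermDeriv α αs b f t + lam * f t) {t : ℝ} (ht : 0 ≤ t) :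
    0 ≤ f t := by
  obtain ⟨s, hs, hmin⟩ := isCompact_Icc.exists_isMinOn (nonempty_Icc.2 ht)
    (hf.continuousOn.mono (Icc_subset_Ici_self : Icc 0 t ⊆ Ici 0))
  refine le_trans ?_ (hmin (right_mem_Icc.2 ht))
  rcases hs.1.eq_or_lt with rfl | hs₀
  · exact h₀
  by_contra! hneg
  have hP_nonpos : 0 ≤ (-1 : ℝ) • multiTermDeriv α αs b f s := by
    rw [← multiTermDeriv_const_smul]
    refine (hf.const_mul (-1)).multiTermDeriv_nonneg_of_max hP hs₀ fun τ hτ => ?_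
    linarith [show f s ≤ f τ from hmin ⟨hτ.1, hτ.2.trans hs.2⟩]
  rw [neg_one_smul] at hP_nonpos
  linarith [h s hs₀, mul_neg_of_pos_of_neg hlam hneg]

end CaputoRegular

/-! ### Caputo derivatives of powers and of generalized power series -/

section Kernel

variable {β γ t : ℝ}

theorem intervalIntegrable_sub_rpow_neg (hβ : β < 1) :
    IntervalIntegrable (fun τ : ℝ => (t - τ) ^ (-β)) volume 0 t := by
  simpa using (intervalIntegral.intervalIntegrable_rpow' (a := t) (b := 0)
    (show -1 < -β by linarith)).comp_sub_left t

theorem integral_sub_rpow_neg (hβ : β < 1) :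
    ∫ τ in (0 : ℝ)..t, (t - τ) ^ (-β) = t ^ (1 - β) / (1 - β) := by
  rw [intervalIntegral.integral_comp_sub_left (fun x => x ^ (-β)) t, sub_self, sub_zero,
    integral_rpow (Or.inl (by linarith)), neg_add_eq_sub, Real.zero_rpow (by linarith), sub_zero]

theorem intervalIntegrable_sub_rpow_neg_mul_rpow (hβ : β < 1) (hγ : 0 < γ) (ht : 0 < t) :
    IntervalIntegrable (fun τ : ℝ => (t - τ) ^ (-β) * τ ^ (γ - 1)) volume 0 t := by
  have hleft : IntervalIntegrable (fun τ : ℝ => (t - τ) ^ (-β) * τ ^ (γ - 1)) volume 0 (t / 2) := by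
    refine (intervalIntegral.intervalIntegrable_rpow' (by linarith)).continuousOn_mul ?_
    rw [uIcc_of_le (by linarith)]
    exact ContinuousOn.rpow_const (by fun_prop) fun τ hτ => Or.inl (by linarith [hτ.2])
  have hright :
      IntervalIntegrable (fun τ : ℝ => (t - τ) ^ (-β) * τ ^ (γ - 1)) volume (t / 2) t := by
    refine ((intervalIntegrable_sub_rpow_neg hβ).mono_set ?_).mul_continuousOn ?_
    · rw [uIcc_of_le (by linarith), uIcc_of_le (by linarith)]
      exact Icc_subset_Icc_left (by linarith)
    · rw [uIcc_of_le (by linarith)]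
      exact ContinuousOn.rpow_const (by fun_prop) fun τ hτ => Or.inl (by linarith [hτ.1])
  exact hleft.trans hright

theorem integral_sub_rpow_neg_mul_rpow (hβ : β < 1) (hγ : 0 < γ) (ht : 0 < t) :
    ∫ τ in (0 : ℝ)..t, (t - τ) ^ (-β) * τ ^ (γ - 1)
      = Real.Gamma (1 - β) * Real.Gamma γ / Real.Gamma (γ + 1 - β) * t ^ (γ - β) := by
  have hbeta := Complex.betaIntegral_scaled (γ : ℂ) ((1 - β : ℝ) : ℂ) ht
  rw [Complex.betaIntegral_eq_Gamma_mul_div _ _ (by simpa using hγ) (by simpa using hβ)] at hbeta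
  have hint : ∫ τ in (0 : ℝ)..t, (τ : ℂ) ^ ((γ : ℂ) - 1) * ((t : ℂ) - τ) ^ (((1 - β : ℝ) : ℂ) - 1)
      = ((∫ τ in (0 : ℝ)..t, (t - τ) ^ (-β) * τ ^ (γ - 1) : ℝ) : ℂ) := by
    rw [← intervalIntegral.integral_ofReal]
    refine intervalIntegral.integral_congr fun τ hτ => ?_
    rw [uIcc_of_le ht.le] at hτ
    rw [Complex.ofReal_mul, Complex.ofReal_cpow (sub_nonneg.2 hτ.2), Complex.ofReal_cpow hτ.1,
      mul_comm]
    push_cast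
    ring_nf
  have hpow : (t : ℂ) ^ ((γ : ℂ) + ((1 - β : ℝ) : ℂ) - 1) = ((t ^ (γ - β) : ℝ) : ℂ) := by
    rw [Complex.ofReal_cpow ht.le]
    push_cast
    ring_nf
  rw [hint, hpow, ← Complex.ofReal_add, Complex.Gamma_ofReal, Complex.Gamma_ofReal,
    Complex.Gamma_ofReal, ← add_sub_assoc] at hbeta
  have hreal := Complex.ofReal_injective (hbeta.trans (by push_cast; rfl :
    _ = ((t ^ (γ - β) * (Real.Gamma γ * Real.Gamma (1 - β) / Real.Gamma (γ + 1 - β)) : ℝ) : ℂ)))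
  rw [hreal]
  ring

theorem CaputoDifferentiableAt.of_norm_deriv_le {F : Type*} [NormedAddCommGroup F]
    [NormedSpace ℝ F] [CompleteSpace F] {u : ℝ → F} {M : ℝ} (hβ : β < 1) (hγ : 0 < γ) (ht : 0 < t)
    (hu : ∀ τ ∈ Ioo 0 t, DifferentiableAt ℝ u τ)
    (hM : ∀ τ ∈ Ioo 0 t, ‖deriv u τ‖ ≤ M * τ ^ (γ - 1)) : CaputoDifferentiableAt β u t := by
  refine ⟨hu, ((intervalIntegrable_sub_rpow_neg_mul_rpow hβ hγ ht).const_mul M).mono_fun' ?_ ?_⟩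
  · exact (Measurable.aestronglyMeasurable (by fun_prop)).smul
      (stronglyMeasurable_deriv u).aestronglyMeasurable
  · rw [uIoc_of_le ht.le, ← restrict_Ioo_eq_restrict_Ioc]
    filter_upwards [ae_restrict_mem measurableSet_Ioo] with τ hτ
    have hk : 0 ≤ (t - τ) ^ (-β) := Real.rpow_nonneg (sub_nonneg.2 hτ.2.le) _
    rw [norm_smul, Real.norm_of_nonneg hk, mul_left_comm]
    exact mul_le_mul_of_nonneg_left (hM τ hτ) hk

/-- The factor by which the Caputo derivative of order `β` acts on `t ^ γ`. -/
noncomputable def caputoFactor (β γ : ℝ) : ℝ := Real.Gamma (γ + 1) / Real.Gamma (γ + 1 - β)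

theorem caputoFactor_nonneg (hγ : 0 ≤ γ) (hβ : β < 1) : 0 ≤ caputoFactor β γ :=
  div_nonneg (Real.Gamma_pos_of_pos (by linarith)).le (Real.Gamma_pos_of_pos (by linarith)).le

theorem caputoDeriv_rpow (hβ : β < 1) (hγ : 0 < γ) (ht : 0 < t) :
    caputoDeriv β (fun τ : ℝ => τ ^ γ) t = caputoFactor β γ * t ^ (γ - β) := by
  have hΓ : Real.Gamma (1 - β) ≠ 0 := (Real.Gamma_pos_of_pos (sub_pos.2 hβ)).ne'
  simp only [caputoDeriv, Real.deriv_rpow_const, smul_eq_mul, mul_left_comm _ γ,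
    intervalIntegral.integral_const_mul, integral_sub_rpow_neg_mul_rpow hβ hγ ht, caputoFactor,
    Real.Gamma_add_one hγ.ne']
  field_simp

theorem caputoRegular_rpow (hγ : 0 < γ) : CaputoRegular fun t : ℝ => t ^ γ where
  continuousOn := (Real.continuous_rpow_const hγ.le).continuousOn
  caputoDifferentiableAt β hβ t ht := by
    refine .of_norm_deriv_le (M := γ) hβ hγ ht
      (fun τ hτ => Real.differentiableAt_rpow_const_of_ne γ hτ.1.ne') fun τ hτ => ?_
    rw [Real.deriv_rpow_const, norm_mul, Real.norm_of_nonneg hγ.le,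
      Real.norm_of_nonneg (Real.rpow_nonneg hτ.1.le _)]

end Kernel

/-- The generalized power series `∑ᵢ aᵢ t^{γᵢ}` has nonnegative real exponents and converges
absolutely for every `t > 0`. -/
structure IsEntireRpowSeries {ι : Type*} (a γ : ι → ℝ) : Prop where
  exponent_nonneg : ∀ i, 0 ≤ γ i
  summable_abs : ∀ t : ℝ, 0 < t → Summable fun i => |a i| * t ^ γ i

/-- The sum of the generalized power series `∑ᵢ aᵢ t^{γᵢ}`. -/
noncomputable def rpowSeries {ι : Type*} (a γ : ι → ℝ) (t : ℝ) : ℝ := ∑' i, a i * t ^ γ i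

theorem rpowSeries_zero {ι : Type*} {a γ : ι → ℝ} (hγ : ∀ i, 0 < γ i) : rpowSeries a γ 0 = 0 := by
  simp [rpowSeries, Real.zero_rpow (hγ _).ne']

theorem rpow_sub_one_le_mul {γ γ₀ τ t : ℝ} (hγ : γ₀ ≤ γ) (hτ : 0 < τ) (hτt : τ ≤ t) :
    τ ^ (γ - 1) ≤ t ^ (γ - γ₀) * τ ^ (γ₀ - 1) := by
  rw [← sub_add_sub_cancel γ γ₀ 1, Real.rpow_add hτ]
  have := Real.rpow_le_rpow hτ.le hτt (sub_nonneg.2 hγ)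
  gcongr

namespace IsEntireRpowSeries

variable {ι : Type*} {a γ : ι → ℝ} {γ₀ β t : ℝ}

theorem summable (h : IsEntireRpowSeries a γ) (ht : 0 < t) : Summable fun i => a i * t ^ γ i :=
  .of_abs <| (h.summable_abs t ht).congr fun i => by
    rw [abs_mul, abs_of_nonneg (Real.rpow_nonneg ht.le _)]

theorem abs (h : IsEntireRpowSeries a γ) : IsEntireRpowSeries (fun i => |a i|) γ :=
  ⟨h.exponent_nonneg, fun t ht => by simpa only [abs_abs] using h.summable_abs t ht⟩

theorem sub_exponent (h : IsEntireRpowSeries a γ) (hγ : ∀ i, γ₀ ≤ γ i) :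
    IsEntireRpowSeries a fun i => γ i - γ₀ where
  exponent_nonneg i := sub_nonneg.2 (hγ i)
  summable_abs t ht := ((h.summable_abs t ht).mul_right (t ^ (-γ₀))).congr fun i => by
    rw [sub_eq_add_neg, Real.rpow_add ht, mul_assoc]

theorem mul_exponent (h : IsEntireRpowSeries a γ) : IsEntireRpowSeries (fun i => a i * γ i) γ where
  exponent_nonneg := h.exponent_nonneg
  summable_abs t ht := by
    refine Summable.of_nonneg_of_le (fun i => by positivity) (fun i => ?_)
      (h.summable_abs (Real.exp 1 * t) (by positivity))
    have hexp : γ i ≤ Real.exp 1 ^ γ i := by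
      rw [← Real.exp_mul, one_mul]
      linarith [Real.add_one_le_exp (γ i)]
    rw [Real.mul_rpow (Real.exp_pos 1).le ht.le, abs_mul, abs_of_nonneg (h.exponent_nonneg i),
      mul_assoc]
    gcongr

theorem continuousOn (h : IsEntireRpowSeries a γ) : ContinuousOn (rpowSeries a γ) (Ici 0) := by
  intro t (ht : 0 ≤ t)
  have hIcc : ContinuousOn (rpowSeries a γ) (Icc 0 (t + 1)) := by
    refine continuousOn_tsum (fun i => ?_) (h.summable_abs (t + 1) (by linarith)) fun i s hs => ?_
    · exact continuousOn_const.mul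
        (continuousOn_id.rpow_const fun _ _ => Or.inr (h.exponent_nonneg i))
    · rw [Real.norm_eq_abs, abs_mul, abs_of_nonneg (Real.rpow_nonneg hs.1 _)]
      have := Real.rpow_le_rpow hs.1 hs.2 (h.exponent_nonneg i)
      gcongr
  refine (hIcc t ⟨ht, by linarith⟩).mono_of_mem_nhdsWithin ?_
  rw [← Ici_inter_Iic]
  exact inter_mem_nhdsWithin _ (Iic_mem_nhds (by linarith))

theorem hasDerivAt (h : IsEntireRpowSeries a γ) (ht : 0 < t) :
    HasDerivAt (rpowSeries a γ) (∑' i, a i * γ i * t ^ (γ i - 1)) t := by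
  have hderiv : ∀ i, ∀ s ∈ Ioo (t / 2) (2 * t),
      HasDerivAt (fun s : ℝ => a i * s ^ γ i) (a i * γ i * s ^ (γ i - 1)) s := fun i s hs => by
    rw [mul_assoc]
    exact (Real.hasDerivAt_rpow_const (Or.inl (by linarith [hs.1]))).const_mul (a i)
  have hbound : ∀ i, ∀ s ∈ Ioo (t / 2) (2 * t),
      ‖a i * γ i * s ^ (γ i - 1)‖ ≤ |a i * γ i| * (2 * t) ^ γ i * (2 / t) := fun i s hs => by
    have hs₀ : 0 < s := by linarith [hs.1]
    have hinv : s ^ (0 - 1 : ℝ) ≤ 2 / t := by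
      rw [zero_sub, Real.rpow_neg_one, inv_le_comm₀ hs₀ (by positivity), inv_div]
      exact hs.1.le
    have hrpow := rpow_sub_one_le_mul (h.exponent_nonneg i) hs₀ hs.2.le
    rw [sub_zero] at hrpow
    rw [norm_mul, Real.norm_eq_abs, Real.norm_of_nonneg (Real.rpow_nonneg hs₀.le _), mul_assoc]
    gcongr
    exact hrpow.trans (mul_le_mul_of_nonneg_left hinv (by positivity))
  have hmem : t ∈ Ioo (t / 2) (2 * t) := ⟨by linarith, by linarith⟩
  exact hasDerivAt_tsum_of_isPreconnected
    ((h.mul_exponent.summable_abs (2 * t) (by positivity)).mul_right (2 / t)) isOpen_Ioo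
    isPreconnected_Ioo hderiv hbound hmem (h.summable ht) hmem

theorem deriv_eq (h : IsEntireRpowSeries a γ) (ht : 0 < t) :
    deriv (rpowSeries a γ) t = ∑' i, a i * γ i * t ^ (γ i - 1) :=
  (h.hasDerivAt ht).deriv

theorem mul_deriv (h : IsEntireRpowSeries a γ) (ht : 0 < t) :
    t * deriv (rpowSeries a γ) t = rpowSeries (fun i => a i * γ i) γ t := by
  rw [h.deriv_eq ht, rpowSeries, ← tsum_mul_left]
  refine tsum_congr fun i => ?_
  rw [Real.rpow_sub_one ht.ne']
  field_simp

theorem abs_term_deriv_le (hγ : ∀ i, γ₀ ≤ γ i) {τ : ℝ} (hτ : 0 < τ) (hτt : τ ≤ t) (i : ι) :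
    ‖a i * γ i * τ ^ (γ i - 1)‖ ≤ |a i * γ i| * t ^ (γ i - γ₀) * τ ^ (γ₀ - 1) := by
  rw [norm_mul, Real.norm_eq_abs, Real.norm_of_nonneg (Real.rpow_nonneg hτ.le _), mul_assoc]
  exact mul_le_mul_of_nonneg_left (rpow_sub_one_le_mul (hγ i) hτ hτt) (abs_nonneg _)

theorem norm_deriv_le (h : IsEntireRpowSeries a γ) (hγ : ∀ i, γ₀ ≤ γ i) {τ : ℝ} (hτ : 0 < τ)
    (hτt : τ ≤ t) :
    ‖deriv (rpowSeries a γ) τ‖ ≤ (∑' i, |a i * γ i| * t ^ (γ i - γ₀)) * τ ^ (γ₀ - 1) := by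
  rw [h.deriv_eq hτ, ← tsum_mul_right]
  exact tsum_of_norm_bounded
    (((h.mul_exponent.sub_exponent hγ).summable_abs t (hτ.trans_le hτt)).mul_right _).hasSum
    (abs_term_deriv_le hγ hτ hτt)

theorem caputoRegular (h : IsEntireRpowSeries a γ) (hγ₀ : 0 < γ₀) (hγ : ∀ i, γ₀ ≤ γ i) :
    CaputoRegular (rpowSeries a γ) where
  continuousOn := h.continuousOn
  caputoDifferentiableAt _ hβ _ ht := .of_norm_deriv_le hβ hγ₀ ht
    (fun _ hτ => (h.hasDerivAt hτ.1).differentiableAt) fun _ hτ => h.norm_deriv_le hγ hτ.1 hτ.2.le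

theorem hasSum_caputoDeriv [Countable ι] (h : IsEntireRpowSeries a γ) (hγ₀ : 0 < γ₀)
    (hγ : ∀ i, γ₀ ≤ γ i) (hβ : β < 1) (ht : 0 < t) :
    HasSum (fun i => a i * caputoFactor β (γ i) * t ^ (γ i - β))
      (caputoDeriv β (rpowSeries a γ) t) := by
  have hsum := ((h.mul_exponent.sub_exponent hγ).summable_abs t ht)
  have hintegral := intervalIntegral.hasSum_integral_of_dominated_convergence (μ := volume)
    (a := 0) (b := t) (F := fun i τ => (t - τ) ^ (-β) • (a i * γ i * τ ^ (γ i - 1)))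
    (f := fun τ => (t - τ) ^ (-β) • deriv (rpowSeries a γ) τ)
    (fun i τ => |a i * γ i| * t ^ (γ i - γ₀) * ((t - τ) ^ (-β) * τ ^ (γ₀ - 1)))
    (fun i => Measurable.aestronglyMeasurable (by fun_prop))
    (fun i => ae_of_all _ fun τ hτ => ?_) (ae_of_all _ fun τ _ => hsum.mul_right _) ?_
    (ae_of_all _ fun τ hτ => ?_)
  · refine (hintegral.const_smul (Real.Gamma (1 - β))⁻¹).congr_fun fun i => ?_
    rw [mul_assoc, ← caputoDeriv_rpow hβ (hγ₀.trans_le (hγ i)) ht, ← smul_eq_mul,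
      ← caputoDeriv_const_smul, caputoDeriv]
    simp only [deriv_const_mul_field, Real.deriv_rpow_const, smul_eq_mul, mul_assoc]
  · rw [uIoc_of_le ht.le] at hτ
    have hk : 0 ≤ (t - τ) ^ (-β) := Real.rpow_nonneg (sub_nonneg.2 hτ.2) _
    rw [norm_smul, Real.norm_of_nonneg hk, mul_left_comm]
    exact mul_le_mul_of_nonneg_left (abs_term_deriv_le hγ hτ.1 hτ.2 i) hk
  · simp only [tsum_mul_right]
    exact (intervalIntegrable_sub_rpow_neg_mul_rpow hβ hγ₀ ht).const_mul _
  · rw [uIoc_of_le ht.le] at hτ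
    rw [h.deriv_eq hτ.1]
    exact (Summable.of_norm_bounded (hsum.mul_right _)
      (abs_term_deriv_le hγ hτ.1 hτ.2)).hasSum.const_smul _

theorem caputoDeriv_eq [Countable ι] (h : IsEntireRpowSeries a γ) (hγ₀ : 0 < γ₀)
    (hγ : ∀ i, γ₀ ≤ γ i) (hβ : β < 1) (ht : 0 < t) :
    caputoDeriv β (rpowSeries a γ) t
      = rpowSeries (fun i => a i * caputoFactor β (γ i)) (fun i => γ i - β) t :=
  (h.hasSum_caputoDeriv hγ₀ hγ hβ ht).tsum_eq.symm

theorem mul_caputoFactor [Countable ι] (h : IsEntireRpowSeries a γ) (hγ₀ : 0 < γ₀)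
    (hγ : ∀ i, γ₀ ≤ γ i) (hβ : β < 1) (hβγ : β ≤ γ₀) :
    IsEntireRpowSeries (fun i => a i * caputoFactor β (γ i)) (fun i => γ i - β) where
  exponent_nonneg i := sub_nonneg.2 (hβγ.trans (hγ i))
  summable_abs t ht := (h.abs.hasSum_caputoDeriv hγ₀ hγ hβ ht).summable.congr fun i => by
    rw [abs_mul, abs_of_nonneg (caputoFactor_nonneg (hγ₀.le.trans (hγ i)) hβ)]

/-- The Caputo derivative of order `β` lowers the degree of homogeneity by `β`, so that
`t d/dt ∂ₜ^β = ∂ₜ^β (t d/dt) - β ∂ₜ^β`. -/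
theorem hasDerivAt_caputoDeriv [Countable ι] (h : IsEntireRpowSeries a γ) (hγ₀ : 0 < γ₀)
    (hγ : ∀ i, γ₀ ≤ γ i) (hβ : β < 1) (hβγ : β ≤ γ₀) (ht : 0 < t) :
    HasDerivAt (caputoDeriv β (rpowSeries a γ))
      (t⁻¹ * (caputoDeriv β (rpowSeries (fun i => a i * γ i) γ) t
        - β * caputoDeriv β (rpowSeries a γ) t)) t := by
  have hβs := h.mul_caputoFactor hγ₀ hγ hβ hβγ
  have heq : caputoDeriv β (rpowSeries a γ)
      =ᶠ[𝓝 t] rpowSeries (fun i => a i * caputoFactor β (γ i)) (fun i => γ i - β) := by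
    filter_upwards [lt_mem_nhds ht] with s hs using h.caputoDeriv_eq hγ₀ hγ hβ hs
  refine ((hβs.hasDerivAt ht).congr_of_eventuallyEq heq).congr_deriv ?_
  rw [eq_inv_mul_iff_mul_eq₀ ht.ne', ← hβs.deriv_eq ht, hβs.mul_deriv ht,
    h.caputoDeriv_eq hγ₀ hγ hβ ht, h.mul_exponent.caputoDeriv_eq hγ₀ hγ hβ ht, rpowSeries,
    rpowSeries, rpowSeries, ← tsum_mul_left,
    ← ((h.mul_exponent.mul_caputoFactor hγ₀ hγ hβ hβγ).summable ht).tsum_sub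
      ((hβs.summable ht).mul_left β)]
  exact tsum_congr fun i => by ring

theorem tendsto_rpow_neg_mul (h : IsEntireRpowSeries a γ) {i₀ : ι}
    (hi₀ : ∀ i, i ≠ i₀ → γ i₀ < γ i) :
    Tendsto (fun t => t ^ (-γ i₀) * rpowSeries a γ t) (𝓝[>] 0) (𝓝 (a i₀)) := by
  have hle : ∀ i, γ i₀ ≤ γ i := fun i => by
    rcases eq_or_ne i i₀ with rfl | hi
    exacts [le_rfl, (hi₀ i hi).le]
  have hzero : rpowSeries a (fun i => γ i - γ i₀) 0 = a i₀ := by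
    rw [rpowSeries, tsum_eq_single i₀ fun i hi => ?_, sub_self, Real.rpow_zero, mul_one]
    rw [Real.zero_rpow (sub_pos.2 (hi₀ i hi)).ne', mul_zero]
  have hlim := ((h.sub_exponent hle).continuousOn 0 self_mem_Ici).tendsto
  rw [hzero] at hlim
  refine (hlim.mono_left (nhdsWithin_mono 0 Ioi_subset_Ici_self)).congr' ?_
  filter_upwards [self_mem_nhdsWithin] with t (ht : 0 < t)
  rw [rpowSeries, rpowSeries, ← tsum_mul_left]
  refine tsum_congr fun i => ?_
  rw [sub_eq_add_neg, Real.rpow_add ht]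
  ring

theorem eventually_neg (h : IsEntireRpowSeries a γ) {i₀ : ι} (hi₀ : ∀ i, i ≠ i₀ → γ i₀ < γ i)
    (ha : a i₀ < 0) : ∀ᶠ t in 𝓝[>] 0, rpowSeries a γ t < 0 := by
  filter_upwards [(h.tendsto_rpow_neg_mul hi₀).eventually_lt_const ha, self_mem_nhdsWithin]
    with t hneg (ht : 0 < t)
  exact neg_of_mul_neg_right hneg (Real.rpow_nonneg ht.le _)

end IsEntireRpowSeries

/-! ### The scalar relaxation equation `P(∂ₜ)y + λy = 0` -/

theorem Gamma_le_multiTermDeriv_rpow {m : ℕ} {α : ℝ} {αs b : Fin m → ℝ}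
    (hP : AdmissibleOrders α αs b) {t : ℝ} (ht : 0 < t) :
    Real.Gamma (α + 1) ≤ multiTermDeriv α αs b (fun t : ℝ => t ^ α) t := by
  have hleading : caputoDeriv α (fun t : ℝ => t ^ α) t = Real.Gamma (α + 1) := by
    rw [caputoDeriv_rpow hP.lt_one hP.pos ht, caputoFactor, add_sub_cancel_left, Real.Gamma_one,
      div_one, sub_self, Real.rpow_zero, mul_one]
  rw [multiTermDeriv, hleading]
  refine le_add_of_nonneg_right (Finset.sum_nonneg fun i _ => ?_)
  rw [caputoDeriv_rpow (hP.lower_lt_one i) hP.pos ht]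
  exact smul_nonneg (hP.weight_pos i).le
    (mul_nonneg (caputoFactor_nonneg hP.pos.le (hP.lower_lt_one i)) (Real.rpow_nonneg ht.le _))

theorem exists_first_nonneg {f : ℝ → ℝ} (hf : ContinuousOn f (Ioi 0))
    (hneg : ∀ᶠ t in 𝓝[>] 0, f t < 0) {t : ℝ} (ht : 0 < t) (hft : 0 ≤ f t) :
    ∃ s, 0 < s ∧ 0 ≤ f s ∧ ∀ τ ∈ Ioo 0 s, f τ < 0 := by
  obtain ⟨ε, hε, hneg⟩ := mem_nhdsGT_iff_exists_Ioo_subset.1 hneg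
  have hε : 0 < ε := hε
  have hεt : ε ≤ t := not_lt.1 fun hlt => (hneg ⟨ht, hlt⟩).not_ge hft
  have hcompact : IsCompact (Icc ε t ∩ f ⁻¹' Ici 0) :=
    isCompact_Icc.of_isClosed_subset
      ((hf.mono fun s hs => hε.trans_le hs.1).preimage_isClosed_of_isClosed isClosed_Icc
        isClosed_Ici)
      inter_subset_left
  obtain ⟨s, ⟨hs, hfs⟩, hleast⟩ := hcompact.exists_isLeast ⟨t, ⟨hεt, le_rfl⟩, hft⟩
  refine ⟨s, hε.trans_le hs.1, hfs, fun τ hτ => ?_⟩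
  rcases lt_or_ge τ ε with hτε | hετ
  · exact hneg ⟨hτ.1, hτε⟩
  · exact not_le.1 fun hle => (hleast ⟨⟨hετ, hτ.2.le.trans hs.2⟩, hle⟩).not_gt hτ.2

theorem sub_rpow_neg_mul_le {β t τ c : ℝ} (hβ : 0 ≤ β) (hτ : τ ∈ Ioo 0 t) (hc₀ : 0 ≤ c)
    (hc : c ≤ τ⁻¹) : (t - τ) ^ (-β) * c ≤ (t / 2) ^ (-β) * c + 2 / t * (t - τ) ^ (-β) := by
  have ht : 0 < t := hτ.1.trans hτ.2
  have hk : 0 ≤ (t - τ) ^ (-β) := Real.rpow_nonneg (sub_nonneg.2 hτ.2.le) _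
  rcases le_total τ (t / 2) with hle | hle
  · have hk_le : (t - τ) ^ (-β) ≤ (t / 2) ^ (-β) :=
      Real.rpow_le_rpow_of_nonpos (by positivity) (by linarith) (neg_nonpos.2 hβ)
    exact le_add_of_le_of_nonneg (mul_le_mul_of_nonneg_right hk_le hc₀) (by positivity)
  · have hc_le : c ≤ 2 / t := hc.trans (by
      rw [inv_le_comm₀ hτ.1 (by positivity), inv_div]
      exact hle)
    rw [mul_comm (2 / t)]
    exact le_add_of_nonneg_of_le (by positivity) (mul_le_mul_of_nonneg_left hc_le hk)

/-- A constant `D` with `-∂ₜ^β f(t) ≤ D t^{-β}` for every decreasing `f` of total variation at most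
`1` such that `|f'(τ)| ≤ 1/τ`; it comes from splitting the kernel at `t/2`. -/
noncomputable def caputoDecayConst (β : ℝ) : ℝ :=
  (Real.Gamma (1 - β))⁻¹ * (2 ^ β + 2 / (1 - β))

theorem caputoDecayConst_pos {β : ℝ} (hβ : β < 1) : 0 < caputoDecayConst β := by
  have hβ' : 0 < 1 - β := sub_pos.2 hβ
  have := Real.Gamma_pos_of_pos hβ'
  rw [caputoDecayConst]
  positivity

theorem CaputoRegular.integral_deriv {f : ℝ → ℝ} (hf : CaputoRegular f) {t : ℝ} (ht : 0 < t) :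
    IntervalIntegrable (deriv f) volume 0 t ∧ ∫ τ in (0 : ℝ)..t, deriv f τ = f t - f 0 := by
  have hint : IntervalIntegrable (deriv f) volume 0 t := by
    simpa using (hf.caputoDifferentiableAt 0 one_pos t ht).2
  exact ⟨hint, intervalIntegral.integral_eq_sub_of_hasDerivAt_of_le ht.le
    (hf.continuousOn.mono Icc_subset_Ici_self)
    (fun τ hτ => (hf.differentiableAt hτ.1).hasDerivAt) hint⟩

theorem CaputoRegular.neg_caputoDeriv_le {f : ℝ → ℝ} (hf : CaputoRegular f) {β t : ℝ}
    (hβ₀ : 0 ≤ β) (hβ : β < 1) (ht : 0 < t) (hderiv : ∀ τ ∈ Ioo 0 t, deriv f τ ≤ 0)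
    (hinv : ∀ τ ∈ Ioo 0 t, -deriv f τ ≤ τ⁻¹) (hvar : f 0 - f t ≤ 1) :
    -caputoDeriv β f t ≤ caputoDecayConst β * t ^ (-β) := by
  obtain ⟨hint, hFTC⟩ := hf.integral_deriv ht
  have hnear : IntervalIntegrable (fun τ => (t / 2) ^ (-β) * -deriv f τ) volume 0 t :=
    hint.neg.const_mul _
  have hfar := (intervalIntegrable_sub_rpow_neg (t := t) hβ).const_mul (2 / t)
  rw [caputoDeriv, ← smul_neg, ← intervalIntegral.integral_neg, smul_eq_mul, caputoDecayConst,
    mul_assoc]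
  refine mul_le_mul_of_nonneg_left ?_ (inv_nonneg.2 (Real.Gamma_pos_of_pos (sub_pos.2 hβ)).le)
  calc ∫ τ in (0 : ℝ)..t, -((t - τ) ^ (-β) • deriv f τ)
      ≤ ∫ τ in (0 : ℝ)..t, ((t / 2) ^ (-β) * -deriv f τ + 2 / t * (t - τ) ^ (-β)) := by
        refine intervalIntegral.integral_mono_on_of_le_Ioo ht.le
          (hf.caputoDifferentiableAt β hβ t ht).2.neg (hnear.add hfar) fun τ hτ => ?_
        rw [smul_eq_mul, ← mul_neg]
        exact sub_rpow_neg_mul_le hβ₀ hτ (neg_nonneg.2 (hderiv τ hτ)) (hinv τ hτ)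
    _ = (t / 2) ^ (-β) * (f 0 - f t) + 2 / t * (t ^ (1 - β) / (1 - β)) := by
        rw [intervalIntegral.integral_add hnear hfar, intervalIntegral.integral_const_mul,
          intervalIntegral.integral_const_mul, integral_sub_rpow_neg hβ,
          intervalIntegral.integral_neg, hFTC, neg_sub]
    _ ≤ (t / 2) ^ (-β) * 1 + 2 / t * (t ^ (1 - β) / (1 - β)) := by gcongr
    _ = (2 ^ β + 2 / (1 - β)) * t ^ (-β) := by
        rw [Real.div_rpow ht.le zero_le_two, Real.rpow_neg zero_le_two, sub_eq_neg_add 1 β,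
          Real.rpow_add_one ht.ne']
        field_simp

/-- `y` solves the relaxation equation `P(∂ₜ)y + λy = 0`, `y(0) = 1`, and its Euler derivative
`t y'(t)` solves the equation obtained by applying `t d/dt`. -/
structure IsRelaxation {m : ℕ} (α : ℝ) (αs b : Fin m → ℝ) (lam : ℝ) (y : ℝ → ℝ) : Prop where
  regular : CaputoRegular y
  apply_zero : y 0 = 1
  equation : ∀ t, 0 < t → multiTermDeriv α αs b y t + lam * y t = 0
  euler_regular : CaputoRegular fun t => t * deriv y t
  euler_equation : ∀ t, 0 < t →
    multiTermDeriv α αs b (fun t => t * deriv y t) t + lam * (t * deriv y t)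
      = α * caputoDeriv α y t + ∑ i, αs i * (b i * caputoDeriv (αs i) y t)
  euler_eventually_neg : ∀ᶠ t in 𝓝[>] 0, t * deriv y t < 0

theorem le_one_add_mul_rpow {w x c θ : ℝ} (hx : 0 < x) (hc : 0 ≤ c) (hθ₀ : 0 ≤ θ) (hθ₁ : θ ≤ 1)
    (hw : w ≤ 1) (hwx : w ≤ c * x) : w ≤ (1 + c) * x ^ θ := by
  rw [one_add_mul]
  rcases le_total x 1 with hle | hle
  · have hxθ : x ≤ x ^ θ := by simpa using Real.rpow_le_rpow_of_exponent_ge hx hle hθ₁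
    exact le_add_of_nonneg_of_le (by positivity) (hwx.trans (mul_le_mul_of_nonneg_left hxθ hc))
  · exact le_add_of_le_of_nonneg (hw.trans (Real.one_le_rpow hle hθ₀)) (by positivity)

theorem rpow_le_one_add {x s : ℝ} (hx : 0 < x) (hs₀ : 0 ≤ s) (hs₁ : s ≤ 1) : x ^ s ≤ 1 + x := by
  rcases le_total x 1 with hle | hle
  · linarith [Real.rpow_le_one hx.le hle hs₀]
  · exact (Real.rpow_le_rpow_of_exponent_le hle hs₁).trans (by rw [Real.rpow_one]; linarith)

/-- A constant `C` with `λˢ y(t) ≤ C t^{-αs}` for `0 < t ≤ T`, `0 ≤ s ≤ 1` and every solution `y`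
of `P(∂ₜ)y + λy = 0`, `y(0) = 1`, whatever `λ > 0`. -/
noncomputable def relaxationDecayConst {m : ℕ} (α : ℝ) (αs b : Fin m → ℝ) (T : ℝ) : ℝ :=
  1 + (caputoDecayConst α + ∑ i, b i * (caputoDecayConst (αs i) * T ^ (α - αs i)))

section

variable {m : ℕ} {α : ℝ} {αs b : Fin m → ℝ} {lam : ℝ} {y : ℝ → ℝ}

theorem relaxationDecayConst_pos (hP : AdmissibleOrders α αs b) {T : ℝ} (hT : 0 ≤ T) :
    0 < relaxationDecayConst α αs b T := by
  refine add_pos one_pos (add_pos_of_pos_of_nonneg (caputoDecayConst_pos hP.lt_one)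
    (Finset.sum_nonneg fun i _ => mul_nonneg (hP.weight_pos i).le ?_))
  exact mul_nonneg (caputoDecayConst_pos (hP.lower_lt_one i)).le (Real.rpow_nonneg hT _)

namespace IsRelaxation

theorem deriv_neg (h : IsRelaxation α αs b lam y) (hP : AdmissibleOrders α αs b) (hlam : 0 ≤ lam)
    {t : ℝ} (ht : 0 < t) : deriv y t < 0 := by
  by_contra! hcon
  obtain ⟨s, hs, hzs, hneg⟩ := exists_first_nonneg
    (h.euler_regular.continuousOn.mono Ioi_subset_Ici_self) h.euler_eventually_neg ht
    (mul_nonneg ht.le hcon)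
  have hP_nonneg : 0 ≤ multiTermDeriv α αs b (fun t => t * deriv y t) s := by
    refine h.euler_regular.multiTermDeriv_nonneg_of_max hP hs fun τ hτ => ?_
    rcases hτ.1.eq_or_lt with rfl | hτ₀
    · simpa using hzs
    rcases hτ.2.eq_or_lt with rfl | hτs
    exacts [le_rfl, (hneg τ ⟨hτ₀, hτs⟩).le.trans hzs]
  have hcaputo : ∀ β < 1, caputoDeriv β y s < 0 := fun β hβ =>
    caputoDeriv_neg_of_deriv_neg hβ hs (h.regular.caputoDifferentiableAt β hβ s hs)
      fun τ hτ => neg_of_mul_neg_right (hneg τ hτ) hτ.1.le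
  have hrhs : α * caputoDeriv α y s + ∑ i, αs i * (b i * caputoDeriv (αs i) y s) < 0 :=
    add_neg_of_neg_of_nonpos (mul_neg_of_pos_of_neg hP.pos (hcaputo α hP.lt_one))
      (Finset.sum_nonpos fun i _ => mul_nonpos_of_nonneg_of_nonpos (hP.lower_pos i).le
        (mul_nonpos_of_nonneg_of_nonpos (hP.weight_pos i).le (hcaputo _ (hP.lower_lt_one i)).le))
  exact hrhs.not_ge (h.euler_equation s hs ▸ add_nonneg hP_nonneg (mul_nonneg hlam hzs))

theorem le_one (h : IsRelaxation α αs b lam y) (hP : AdmissibleOrders α αs b) (hlam : 0 ≤ lam)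
    {t : ℝ} (ht : 0 ≤ t) : y t ≤ 1 := by
  have hanti : AntitoneOn y (Ici 0) := by
    refine antitoneOn_of_deriv_nonpos (convex_Ici 0) h.regular.continuousOn ?_ ?_
    all_goals rw [interior_Ici]
    · exact fun s hs => (h.regular.differentiableAt hs).differentiableWithinAt
    · exact fun s hs => (h.deriv_neg hP hlam hs).le
  exact h.apply_zero ▸ hanti self_mem_Ici ht ht

theorem nonneg (h : IsRelaxation α αs b lam y) (hP : AdmissibleOrders α αs b) (hlam : 0 < lam)
    {t : ℝ} (ht : 0 ≤ t) : 0 ≤ y t :=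
  h.regular.nonneg_of_multiTermDeriv_add_nonneg hP hlam (h.apply_zero ▸ zero_le_one)
    (fun s hs => (h.equation s hs).ge) ht

theorem euler_equation_ge (h : IsRelaxation α αs b lam y) (hP : AdmissibleOrders α αs b)
    (hlam : 0 ≤ lam) {t : ℝ} (ht : 0 < t) :
    -(α * (lam * y t))
      ≤ multiTermDeriv α αs b (fun t => t * deriv y t) t + lam * (t * deriv y t) := by
  rw [h.euler_equation t ht, ← mul_neg, ← eq_neg_of_add_eq_zero_left (h.equation t ht),
    multiTermDeriv, mul_add, Finset.mul_sum]
  refine add_le_add_right (Finset.sum_le_sum fun i _ => ?_) _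
  refine mul_le_mul_of_nonpos_right (hP.lower_lt i).le
    (mul_nonpos_of_nonneg_of_nonpos (hP.weight_pos i).le ?_)
  exact caputoDeriv_nonpos (hP.lower_lt_one i) ht.le fun τ hτ => (h.deriv_neg hP hlam hτ.1).le

theorem neg_mul_deriv_le (h : IsRelaxation α αs b lam y) (hP : AdmissibleOrders α αs b)
    (hlam : 0 < lam) {w : ℝ → ℝ} (hw : CaputoRegular w) (hw₀ : 0 ≤ w 0)
    (hsuper : ∀ t, 0 < t → α * lam ≤ multiTermDeriv α αs b w t + lam * w t) {t : ℝ} (ht : 0 ≤ t) :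
    -(t * deriv y t) ≤ w t := by
  rw [neg_le_iff_add_nonneg]
  refine (hw.add h.euler_regular).nonneg_of_multiTermDeriv_add_nonneg hP hlam (by simpa using hw₀)
    (fun s hs => ?_) ht
  rw [hw.multiTermDeriv_add h.euler_regular hP.lt_one hP.lower_lt_one hs]
  have hy := mul_le_mul_of_nonneg_left (h.le_one hP hlam.le hs.le) (mul_pos hP.pos hlam).le
  linarith [h.euler_equation_ge hP hlam.le hs, hsuper s hs]

theorem neg_mul_deriv_le_order (h : IsRelaxation α αs b lam y) (hP : AdmissibleOrders α αs b)
    (hlam : 0 < lam) {t : ℝ} (ht : 0 ≤ t) : -(t * deriv y t) ≤ α :=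
  h.neg_mul_deriv_le hP hlam (caputoRegular_const α) hP.pos.le
    (fun s _ => by rw [multiTermDeriv_const, zero_add, mul_comm]) ht

theorem neg_mul_deriv_le_rpow (h : IsRelaxation α αs b lam y) (hP : AdmissibleOrders α αs b)
    (hlam : 0 < lam) {t : ℝ} (ht : 0 ≤ t) :
    -(t * deriv y t) ≤ α * lam / Real.Gamma (α + 1) * t ^ α := by
  have hα := hP.pos
  have : 0 < Real.Gamma (α + 1) := Real.Gamma_pos_of_pos (by linarith)
  refine h.neg_mul_deriv_le hP hlam ((caputoRegular_rpow hα).const_mul _)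
    (by rw [Real.zero_rpow hα.ne', mul_zero]) (fun s hs => ?_) ht
  simp only [← smul_eq_mul (α * lam / Real.Gamma (α + 1)), multiTermDeriv_const_smul]
  calc α * lam = α * lam / Real.Gamma (α + 1) * Real.Gamma (α + 1) := by field_simp
    _ ≤ α * lam / Real.Gamma (α + 1) * multiTermDeriv α αs b (fun t => t ^ α) s := by
        gcongr
        exact Gamma_le_multiTermDeriv_rpow hP hs
    _ ≤ _ := le_add_of_nonneg_right (by positivity)

theorem abs_deriv_le (h : IsRelaxation α αs b lam y) (hP : AdmissibleOrders α αs b)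
    (hlam : 0 < lam) {θ t : ℝ} (hθ₀ : 0 ≤ θ) (hθ₁ : θ ≤ 1) (ht : 0 < t) :
    |deriv y t| ≤ (1 + α / Real.Gamma (α + 1)) * lam ^ θ * t ^ (α * θ - 1) := by
  have hΓ : 0 < Real.Gamma (α + 1) := Real.Gamma_pos_of_pos (by linarith [hP.pos])
  have hinterp : -(t * deriv y t) ≤ (1 + α / Real.Gamma (α + 1)) * (lam * t ^ α) ^ θ := by
    refine le_one_add_mul_rpow (by positivity) (div_nonneg hP.pos.le hΓ.le) hθ₀ hθ₁
      ((h.neg_mul_deriv_le_order hP hlam ht.le).trans hP.lt_one.le)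
      ((h.neg_mul_deriv_le_rpow hP hlam ht.le).trans_eq (by ring))
  rw [abs_of_neg (h.deriv_neg hP hlam.le ht), Real.rpow_sub_one ht.ne', mul_div_assoc',
    le_div_iff₀ ht, mul_assoc, Real.rpow_mul ht.le, ← Real.mul_rpow hlam.le (by positivity)]
  linarith

theorem neg_caputoDeriv_le (h : IsRelaxation α αs b lam y) (hP : AdmissibleOrders α αs b)
    (hlam : 0 < lam) {β t : ℝ} (hβ₀ : 0 ≤ β) (hβ : β < 1) (ht : 0 < t) :
    -caputoDeriv β y t ≤ caputoDecayConst β * t ^ (-β) := by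
  refine h.regular.neg_caputoDeriv_le hβ₀ hβ ht (fun τ hτ => (h.deriv_neg hP hlam.le hτ.1).le)
    (fun τ hτ => ?_) (by linarith [h.apply_zero, h.nonneg hP hlam ht.le])
  rw [inv_eq_one_div, le_div_iff₀ hτ.1]
  linarith [h.neg_mul_deriv_le_order hP hlam hτ.1.le, hP.lt_one]

theorem mul_le (h : IsRelaxation α αs b lam y) (hP : AdmissibleOrders α αs b) (hlam : 0 < lam)
    {T t : ℝ} (ht : t ∈ Ioc 0 T) :
    lam * y t ≤ (caputoDecayConst α + ∑ i, b i * (caputoDecayConst (αs i) * T ^ (α - αs i)))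
      * t ^ (-α) := by
  have heq : lam * y t = -caputoDeriv α y t + ∑ i, b i * -caputoDeriv (αs i) y t := by
    have := h.equation t ht.1
    simp only [multiTermDeriv, smul_eq_mul] at this
    simp only [mul_neg, Finset.sum_neg_distrib]
    linarith
  rw [heq, add_mul, Finset.sum_mul]
  refine add_le_add (h.neg_caputoDeriv_le hP hlam hP.pos.le hP.lt_one ht.1)
    (Finset.sum_le_sum fun i _ => ?_)
  have hpow : t ^ (-αs i) ≤ T ^ (α - αs i) * t ^ (-α) := by
    rw [show -αs i = (α - αs i) + -α by ring, Real.rpow_add ht.1]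
    exact mul_le_mul_of_nonneg_right
      (Real.rpow_le_rpow ht.1.le ht.2 (sub_nonneg.2 (hP.lower_lt i).le))
      (Real.rpow_nonneg ht.1.le _)
  rw [mul_assoc, mul_assoc]
  refine mul_le_mul_of_nonneg_left ?_ (hP.weight_pos i).le
  exact (h.neg_caputoDeriv_le hP hlam (hP.lower_pos i).le (hP.lower_lt_one i) ht.1).trans
    (mul_le_mul_of_nonneg_left hpow (caputoDecayConst_pos (hP.lower_lt_one i)).le)

theorem rpow_mul_le (h : IsRelaxation α αs b lam y) (hP : AdmissibleOrders α αs b)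
    (hlam : 0 < lam) {s T t : ℝ} (hs₀ : 0 ≤ s) (hs₁ : s ≤ 1) (ht : t ∈ Ioc 0 T) :
    lam ^ s * y t ≤ relaxationDecayConst α αs b T * t ^ (-(α * s)) := by
  have htα : 0 < t ^ α := Real.rpow_pos_of_pos ht.1 α
  have hdecay := h.mul_le hP hlam ht
  rw [Real.rpow_neg ht.1.le, ← div_eq_mul_inv, le_div_iff₀ htα] at hdecay
  rw [Real.rpow_neg ht.1.le, ← div_eq_mul_inv, le_div_iff₀ (Real.rpow_pos_of_pos ht.1 _)]
  calc lam ^ s * y t * t ^ (α * s)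
      = (lam * t ^ α) ^ s * y t := by
        rw [Real.mul_rpow hlam.le htα.le, ← Real.rpow_mul ht.1.le]
        ring
    _ ≤ (1 + lam * t ^ α) * y t :=
        mul_le_mul_of_nonneg_right (rpow_le_one_add (mul_pos hlam htα) hs₀ hs₁)
          (h.nonneg hP hlam ht.1.le)
    _ = y t + lam * y t * t ^ α := by ring
    _ ≤ relaxationDecayConst α αs b T := add_le_add (h.le_one hP hlam.le ht.1.le) hdecay

end IsRelaxation

end

/-! ### The multinomial Mittag-Leffler function -/

open Finset (piAntidiag)

section Multinomial

variable {ι R : Type*} [Fintype ι] [CommSemiring R]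

/-- The coefficient `k!/(l₁!⋯lₙ!) ∏ zᵢ^{lᵢ}` of `X^l` in `(∑ zᵢ Xᵢ)^k`, where `k = l₁ + ⋯ + lₙ`. -/
noncomputable def multinomialCoeff (z : ι → R) (l : ι → ℕ) : R :=
  Nat.multinomial Finset.univ l * ∏ i, z i ^ l i

theorem multinomialCoeff_zero (z : ι → R) : multinomialCoeff z 0 = 1 := by
  simp [multinomialCoeff, Nat.multinomial]

variable [DecidableEq ι]

theorem sum_C_mul_X_pow (z : ι → R) (k : ℕ) :
    (∑ i, MvPolynomial.C (z i) * MvPolynomial.X i) ^ k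
      = ∑ l ∈ piAntidiag Finset.univ k,
        MvPolynomial.monomial (Finsupp.equivFunOnFinite.symm l) (multinomialCoeff z l) := by
  rw [Finset.sum_pow_eq_sum_piAntidiag]
  refine Finset.sum_congr rfl fun l _ => ?_
  rw [MvPolynomial.monomial_eq, Finsupp.prod_fintype _ _ fun _ => pow_zero _]
  simp [multinomialCoeff, mul_pow, Finset.prod_mul_distrib, mul_assoc]

-- Apply the linear functional `X^l ↦ w l` to `(∑ zᵢ Xᵢ)^(k+1) = ∑ᵢ zᵢ Xᵢ (∑ zⱼ Xⱼ)^k`.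
theorem sum_piAntidiag_succ_multinomialCoeff_mul (z : ι → R) (w : (ι → ℕ) → R) (k : ℕ) :
    ∑ l ∈ piAntidiag Finset.univ (k + 1), multinomialCoeff z l * w l
      = ∑ i, z i * ∑ l ∈ piAntidiag Finset.univ k,
        multinomialCoeff z l * w (l + Pi.single i 1) := by
  let Λ : MvPolynomial ι R →ₗ[R] R := (MvPolynomial.basisMonomials ι R).constr R fun l => w l
  have hΛ : ∀ (l : ι →₀ ℕ) (c : R), Λ (MvPolynomial.monomial l c) = c * w l := fun l c => by
    rw [show MvPolynomial.monomial l c = c • MvPolynomial.basisMonomials ι R l by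
        simp [MvPolynomial.smul_monomial], map_smul, Module.Basis.constr_basis, smul_eq_mul]
  have hshift : ∀ (l : ι → ℕ) (i : ι),
      ⇑(Finsupp.equivFunOnFinite.symm l + Finsupp.single i 1 : ι →₀ ℕ) = l + Pi.single i 1 :=
    fun l i => by
      rw [Finsupp.coe_add, Finsupp.coe_equivFunOnFinite_symm, Finsupp.single_eq_pi_single]
  calc ∑ l ∈ piAntidiag Finset.univ (k + 1), multinomialCoeff z l * w l
      = Λ ((∑ i, MvPolynomial.C (z i) * MvPolynomial.X i) ^ (k + 1)) := by
        simp only [sum_C_mul_X_pow, map_sum, hΛ, Finsupp.coe_equivFunOnFinite_symm]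
    _ = ∑ i, z i * Λ ((∑ j, MvPolynomial.C (z j) * MvPolynomial.X j) ^ k * MvPolynomial.X i) := by
        rw [pow_succ, Finset.mul_sum, map_sum]
        refine Finset.sum_congr rfl fun i _ => ?_
        rw [mul_left_comm, ← MvPolynomial.smul_eq_C_mul, map_smul, smul_eq_mul]
    _ = _ := by
        simp only [sum_C_mul_X_pow, Finset.sum_mul]
        simp only [MvPolynomial.X, MvPolynomial.monomial_mul, mul_one, map_sum, hΛ, hshift]

end Multinomial

theorem hasSum_piAntidiag {ι : Type*} [Fintype ι] [DecidableEq ι] {f : (ι → ℕ) → ℝ} {s : ℝ}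
    (hf : HasSum f s) : HasSum (fun k => ∑ l ∈ piAntidiag Finset.univ k, f l) s := by
  have hfiber : ∀ k : ℕ, (fun l : ι → ℕ => ∑ i, l i) ⁻¹' {k}
      = ((piAntidiag Finset.univ k : Finset (ι → ℕ)) : Set (ι → ℕ)) := fun k => by ext; simp
  refine (hf.tsum_fiberwise fun l => ∑ i, l i).congr_fun fun k => ?_
  rw [hfiber, Finset.tsum_subtype']

theorem summable_of_summable_sum_piAntidiag {ι : Type*} [Fintype ι] [DecidableEq ι]
    {f : (ι → ℕ) → ℝ} (hf : 0 ≤ f)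
    (h : Summable fun k => ∑ l ∈ piAntidiag Finset.univ k, f l) : Summable f := by
  refine (summable_partition hf
    (s := fun k : ℕ => ((piAntidiag Finset.univ k : Finset (ι → ℕ)) : Set (ι → ℕ)))
    fun l => ⟨∑ i, l i, by simp, fun k hk => by simpa [eq_comm] using hk⟩).2
    ⟨fun k => (piAntidiag Finset.univ k).summable f, ?_⟩
  simpa only [Finset.tsum_subtype'] using h

theorem inv_Gamma_one_add_le {x r : ℝ} (hx : 0 ≤ x) (hr : 0 < r) :
    (Real.Gamma (1 + x))⁻¹ ≤ Real.exp r * r ^ (-x) := by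
  have hint := Real.GammaIntegral_convergent (s := 1 + x) (by linarith)
  have hlower : r ^ x * Real.exp (-r) ≤ Real.Gamma (1 + x) := by
    rw [Real.Gamma_eq_integral (by linarith)]
    calc r ^ x * Real.exp (-r) = ∫ s in Ioi r, r ^ x * Real.exp (-s) := by
          rw [integral_const_mul, integral_exp_neg_Ioi]
      _ ≤ ∫ s in Ioi r, Real.exp (-s) * s ^ (1 + x - 1) := by
          refine setIntegral_mono_on ((integrableOn_exp_neg_Ioi r).const_mul _)
            (hint.mono_set (Ioi_subset_Ioi hr.le)) measurableSet_Ioi fun s (hs : r < s) => ?_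
          rw [add_sub_cancel_left, mul_comm]
          gcongr
      _ ≤ ∫ s in Ioi 0, Real.exp (-s) * s ^ (1 + x - 1) := by
          refine setIntegral_mono_set hint ?_ (Ioi_subset_Ioi hr.le).eventuallyLE
          filter_upwards [ae_restrict_mem measurableSet_Ioi] with s (hs : 0 < s)
          simp only [Pi.zero_apply]
          positivity
  calc (Real.Gamma (1 + x))⁻¹ ≤ (r ^ x * Real.exp (-r))⁻¹ := inv_anti₀ (by positivity) hlower
    _ = Real.exp r * r ^ (-x) := by
        rw [mul_inv, Real.rpow_neg hr.le, Real.exp_neg, inv_inv, mul_comm]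

section MittagLeffler

variable {ι : Type*} [Fintype ι] {β z : ι → ℝ} {μ t : ℝ}

/-- The exponent `μ + β·l` of the term of index `l` in `mlSeries β z μ`. -/
noncomputable def mlExponent (β : ι → ℝ) (μ : ℝ) (l : ι → ℕ) : ℝ := μ + ∑ i, β i * l i

/-- The coefficient of the term of index `l` in `mlSeries β z μ`. -/
noncomputable def mlCoeff (β z : ι → ℝ) (μ : ℝ) (l : ι → ℕ) : ℝ :=
  multinomialCoeff z l / Real.Gamma (1 + mlExponent β μ l)

/-- `t^μ E_{β,1+μ}(z₁ t^{β₁}, …, zₙ t^{βₙ})` as a generalized power series in `t`, indexed by all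
multi-indices. -/
noncomputable def mlSeries (β z : ι → ℝ) (μ : ℝ) : ℝ → ℝ :=
  rpowSeries (mlCoeff β z μ) (mlExponent β μ)

theorem mlExponent_zero : mlExponent β μ 0 = μ := by simp [mlExponent]

theorem le_mlExponent (hβ : ∀ i, 0 ≤ β i) (μ : ℝ) (l : ι → ℕ) : μ ≤ mlExponent β μ l :=
  le_add_of_nonneg_right (Finset.sum_nonneg fun i _ => mul_nonneg (hβ i) (Nat.cast_nonneg _))

theorem lt_mlExponent (hβ : ∀ i, 0 < β i) (μ : ℝ) {l : ι → ℕ} (hl : l ≠ 0) :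
    μ < mlExponent β μ l := by
  obtain ⟨i, hi⟩ := Function.ne_iff.1 hl
  exact lt_add_of_pos_right _ (Finset.sum_pos' (fun j _ => mul_nonneg (hβ j).le (Nat.cast_nonneg _))
    ⟨i, Finset.mem_univ i, mul_pos (hβ i) (Nat.cast_pos.2 (Nat.pos_of_ne_zero hi))⟩)

theorem Gamma_one_add_mlExponent_pos (hβ : ∀ i, 0 ≤ β i) (hμ : 0 ≤ μ) (l : ι → ℕ) :
    0 < Real.Gamma (1 + mlExponent β μ l) :=
  Real.Gamma_pos_of_pos (by linarith [le_mlExponent hβ μ l])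

theorem mlExponent_add_single [DecidableEq ι] (μ : ℝ) (l : ι → ℕ) (i : ι) :
    mlExponent β μ (l + Pi.single i 1) = mlExponent β (μ + β i) l := by
  simp [mlExponent, Pi.single_apply, mul_add, Finset.sum_add_distrib]
  ring

theorem multinomialCoeff_mul_rpow_mlExponent (z : ι → ℝ) (ht : 0 < t) (l : ι → ℕ) :
    multinomialCoeff z l * t ^ mlExponent β μ l
      = t ^ μ * multinomialCoeff (fun i => z i * t ^ β i) l := by
  rw [multinomialCoeff, multinomialCoeff, mlExponent, Real.rpow_add ht, Real.rpow_sum_of_pos ht]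
  simp only [mul_pow, Finset.prod_mul_distrib, Real.rpow_mul_natCast ht.le]
  ring

theorem abs_multinomialCoeff (z : ι → ℝ) (l : ι → ℕ) :
    |multinomialCoeff z l| = multinomialCoeff (fun i => |z i|) l := by
  simp only [multinomialCoeff, abs_mul, Nat.abs_cast, Finset.abs_prod, abs_pow]

theorem exists_sum_mul_rpow_lt_one (hβ : ∀ i, 0 < β i) (z : ι → ℝ) :
    ∃ x : ℝ, 0 < x ∧ ∑ i, z i * x ^ β i < 1 := by
  have hcont : ContinuousAt (fun x : ℝ => ∑ i, z i * x ^ β i) 0 :=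
    tendsto_finsetSum _ fun i _ =>
      (Real.continuousAt_rpow_const 0 (β i) (Or.inr (hβ i).le)).const_mul _
  have hzero : ∑ i, z i * (0 : ℝ) ^ β i < 1 := by simp [Real.zero_rpow (hβ _).ne']
  obtain ⟨x, hx, hx₀⟩ := (((hcont.eventually_lt_const hzero).filter_mono
    (nhdsWithin_le_nhds (s := Ioi 0))).and self_mem_nhdsWithin).exists
  exact ⟨x, hx₀, hx⟩

-- Summing over `|l| = k` first gives a geometric series when `x` is small.
theorem exists_summable_abs_multinomialCoeff_mul_rpow (hβ : ∀ i, 0 < β i) (z : ι → ℝ)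
    (μ : ℝ) : ∃ x : ℝ, 0 < x ∧ Summable fun l => |multinomialCoeff z l| * x ^ mlExponent β μ l := by
  classical
  obtain ⟨x, hx, hlt⟩ := exists_sum_mul_rpow_lt_one hβ fun i => |z i|
  refine ⟨x, hx, summable_of_summable_sum_piAntidiag (fun l => by positivity) ?_⟩
  have hlevel : ∀ k, ∑ l ∈ piAntidiag Finset.univ k, |multinomialCoeff z l| * x ^ mlExponent β μ l
      = x ^ μ * (∑ i, |z i| * x ^ β i) ^ k := fun k => by
    simp only [abs_multinomialCoeff, multinomialCoeff_mul_rpow_mlExponent _ hx, ← Finset.mul_sum]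
    rw [Finset.sum_pow_eq_sum_piAntidiag]
    rfl
  simp only [hlevel]
  exact (summable_geometric_of_lt_one (Finset.sum_nonneg fun i _ => by positivity) hlt).mul_left _

theorem isEntireRpowSeries_mlSeries (hβ : ∀ i, 0 < β i) (z : ι → ℝ) (hμ : 0 ≤ μ) :
    IsEntireRpowSeries (mlCoeff β z μ) (mlExponent β μ) where
  exponent_nonneg l := hμ.trans (le_mlExponent (fun i => (hβ i).le) μ l)
  summable_abs R hR := by
    obtain ⟨x, hx, hsum⟩ := exists_summable_abs_multinomialCoeff_mul_rpow hβ z μ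
    refine .of_nonneg_of_le (fun l => by positivity) (fun l => ?_)
      (hsum.mul_left (Real.exp (R / x)))
    have hexp := hμ.trans (le_mlExponent (fun i => (hβ i).le) μ l)
    rw [mlCoeff, abs_div,
      abs_of_pos (Gamma_one_add_mlExponent_pos (fun i => (hβ i).le) hμ l), div_eq_mul_inv]
    calc |multinomialCoeff z l| * (Real.Gamma (1 + mlExponent β μ l))⁻¹ * R ^ mlExponent β μ l
        ≤ |multinomialCoeff z l| * (Real.exp (R / x) * (R / x) ^ (-mlExponent β μ l))
            * R ^ mlExponent β μ l := by
          gcongr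
          exact inv_Gamma_one_add_le hexp (by positivity)
      _ = Real.exp (R / x) * (|multinomialCoeff z l| * x ^ mlExponent β μ l) := by
          rw [Real.rpow_neg (by positivity), Real.div_rpow hR.le hx.le]
          have := Real.rpow_pos_of_pos hR (mlExponent β μ l)
          field_simp

theorem hasSum_mlSeries [DecidableEq ι] (hβ : ∀ i, 0 < β i) (z : ι → ℝ) (hμ : 0 ≤ μ)
    (ht : 0 < t) :
    HasSum (fun k => ∑ l ∈ piAntidiag Finset.univ k, mlCoeff β z μ l * t ^ mlExponent β μ l)
      (mlSeries β z μ t) :=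
  hasSum_piAntidiag ((isEntireRpowSeries_mlSeries hβ z hμ).summable ht).hasSum

theorem mlSeries_zero_eq_one_add (hβ : ∀ i, 0 < β i) (z : ι → ℝ) (ht : 0 < t) :
    mlSeries β z 0 t = 1 + ∑ i, z i * mlSeries β z (β i) t := by
  classical
  have hsum := hasSum_mlSeries hβ z le_rfl ht
  rw [← hsum.tsum_eq, hsum.summable.tsum_eq_zero_add]
  congr 1
  · simp [mlCoeff, multinomialCoeff_zero, mlExponent_zero]
  · have hshift := hasSum_sum (s := Finset.univ)
      fun i _ => (hasSum_mlSeries hβ z (hβ i).le ht).mul_left (z i)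
    rw [← hshift.tsum_eq]
    refine tsum_congr fun k => ?_
    simp only [mlCoeff, div_mul_eq_mul_div, mul_div_assoc,
      sum_piAntidiag_succ_multinomialCoeff_mul, mlExponent_add_single, zero_add]

theorem caputoDeriv_mlSeries (hβ : ∀ i, 0 < β i) (z : ι → ℝ) (hμ : 0 < μ) {ν : ℝ}
    (hν : ν < 1) (ht : 0 < t) : caputoDeriv ν (mlSeries β z μ) t = mlSeries β z (μ - ν) t := by
  have hβ₀ : ∀ i, 0 ≤ β i := fun i => (hβ i).le
  rw [mlSeries, (isEntireRpowSeries_mlSeries hβ z hμ.le).caputoDeriv_eq hμ (le_mlExponent hβ₀ μ)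
    hν ht, mlSeries]
  have hexp : ∀ l, mlExponent β (μ - ν) l = mlExponent β μ l - ν := fun l => sub_add_eq_add_sub ..
  refine tsum_congr fun l => ?_
  have hΓ := (Gamma_one_add_mlExponent_pos hβ₀ hμ.le l).ne'
  simp only [hexp, mlCoeff, caputoFactor, add_comm _ (1 : ℝ), add_sub_assoc]
  field_simp

theorem rpow_mul_multinomialML {n : ℕ} {β : Fin n → ℝ} (hβ : ∀ i, 0 < β i) (z : Fin n → ℝ)
    (hμ : 0 ≤ μ) (ht : 0 < t) :
    t ^ μ * multinomialML β (1 + μ) (fun i => z i * t ^ β i) = mlSeries β z μ t := by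
  rw [← (hasSum_mlSeries hβ z hμ ht).tsum_eq, multinomialML, ← tsum_mul_left]
  refine tsum_congr fun k => ?_
  rw [Finset.mul_sum]
  refine Finset.sum_congr rfl fun l _ => ?_
  rw [mlCoeff, div_mul_eq_mul_div, multinomialCoeff_mul_rpow_mlExponent z ht, mlExponent, add_assoc,
    multinomialCoeff]
  ring

end MittagLeffler

theorem rpowSeries_const_mul {ι : Type*} (c : ℝ) (a γ : ι → ℝ) (t : ℝ) :
    rpowSeries (fun i => c * a i) γ t = c * rpowSeries a γ t := by
  simp only [rpowSeries, mul_assoc, tsum_mul_left]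

theorem IsEntireRpowSeries.const_mul {ι : Type*} {a γ : ι → ℝ} (h : IsEntireRpowSeries a γ)
    (c : ℝ) : IsEntireRpowSeries (fun i => c * a i) γ where
  exponent_nonneg := h.exponent_nonneg
  summable_abs R hR := by simpa only [abs_mul, mul_assoc] using (h.summable_abs R hR).mul_left |c|

section Mode

variable {m : ℕ} {α lam t : ℝ} {αs b : Fin m → ℝ}

namespace IsEntireRpowSeries

variable {ι : Type*} [Countable ι] {a γ : ι → ℝ}

-- Apply `t d/dt` to the equation `P(∂ₜ) g + λ (1 + g) = 0`, using
-- `t d/dt ∂ₜ^β = ∂ₜ^β (t d/dt) - β ∂ₜ^β`.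
theorem euler_equation (h : IsEntireRpowSeries a γ) (hP : AdmissibleOrders α αs b)
    (hγ : ∀ i, α ≤ γ i)
    (heq : ∀ t, 0 < t → multiTermDeriv α αs b (rpowSeries a γ) t
      + lam * (1 + rpowSeries a γ t) = 0) (ht : 0 < t) :
    multiTermDeriv α αs b (rpowSeries (fun i => a i * γ i) γ) t
        + lam * rpowSeries (fun i => a i * γ i) γ t
      = α * caputoDeriv α (rpowSeries a γ) t
        + ∑ i, αs i * (b i * caputoDeriv (αs i) (rpowSeries a γ) t) := by
  have hderiv := ((h.hasDerivAt_caputoDeriv hP.pos hγ hP.lt_one le_rfl ht).add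
    (HasDerivAt.fun_sum (u := Finset.univ) fun i _ =>
      (h.hasDerivAt_caputoDeriv hP.pos hγ (hP.lower_lt_one i) (hP.lower_lt i).le ht).const_mul
        (b i))).add (((h.hasDerivAt ht).const_add 1).const_mul lam)
  have hzero := (hderiv.congr_of_eventuallyEq (f₁ := fun _ => (0 : ℝ)) (by
    filter_upwards [lt_mem_nhds ht] with s hs using (heq s hs).symm)).unique (hasDerivAt_const t 0)
  rw [← h.deriv_eq ht] at hzero
  have hscaled := congrArg (t * ·) hzero
  simp only [mul_zero, mul_add, Finset.mul_sum] at hscaled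
  rw [mul_inv_cancel_left₀ ht.ne', mul_left_comm t lam, h.mul_deriv ht] at hscaled
  have hterm : ∀ i, t * (b i * (t⁻¹ * (caputoDeriv (αs i) (rpowSeries (fun i => a i * γ i) γ) t
      - αs i * caputoDeriv (αs i) (rpowSeries a γ) t)))
      = b i * caputoDeriv (αs i) (rpowSeries (fun i => a i * γ i) γ) t
        - αs i * (b i * caputoDeriv (αs i) (rpowSeries a γ) t) := fun i => by
    field_simp
  simp only [hterm, Finset.sum_sub_distrib] at hscaled
  simp only [multiTermDeriv, smul_eq_mul]
  linarith

theorem isRelaxation (h : IsEntireRpowSeries a γ) (hP : AdmissibleOrders α αs b) {i₀ : ι}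
    (hγ₀ : γ i₀ = α) (hi₀ : ∀ i, i ≠ i₀ → α < γ i) (ha : a i₀ < 0)
    (heq : ∀ t, 0 < t → multiTermDeriv α αs b (rpowSeries a γ) t
      + lam * (1 + rpowSeries a γ t) = 0) :
    IsRelaxation α αs b lam fun t => 1 + rpowSeries a γ t := by
  have hγ : ∀ i, α ≤ γ i := fun i => by
    rcases eq_or_ne i i₀ with rfl | hi
    exacts [hγ₀.ge, (hi₀ i hi).le]
  have hreg : CaputoRegular (rpowSeries a γ) := h.caputoRegular hP.pos hγ
  have hcaputo : ∀ β < 1, ∀ t, 0 < t →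
      caputoDeriv β (fun t => 1 + rpowSeries a γ t) t = caputoDeriv β (rpowSeries a γ) t :=
    fun β hβ t ht => by
      rw [caputoDeriv_add ((caputoRegular_const 1).caputoDifferentiableAt β hβ t ht)
        (hreg.caputoDifferentiableAt β hβ t ht) ht.le, caputoDeriv_const, zero_add]
  have heuler : ∀ t, 0 ≤ t → rpowSeries (fun i => a i * γ i) γ t
      = t * deriv (fun t => 1 + rpowSeries a γ t) t := fun t ht => by
    rcases ht.eq_or_lt with rfl | ht
    · rw [rpowSeries_zero fun i => hP.pos.trans_le (hγ i), zero_mul]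
    · rw [deriv_const_add', h.mul_deriv ht]
  refine ⟨(caputoRegular_const 1).add hreg, ?_, fun t ht => ?_,
    (h.mul_exponent.caputoRegular hP.pos hγ).congr fun t ht => heuler t ht, fun t ht => ?_, ?_⟩
  · rw [rpowSeries_zero fun i => hP.pos.trans_le (hγ i), add_zero]
  · rw [(caputoRegular_const 1).multiTermDeriv_add hreg hP.lt_one hP.lower_lt_one ht,
      multiTermDeriv_const, zero_add, heq t ht]
  · rw [← multiTermDeriv_congr ht.le fun s hs => heuler s hs.1.le, ← heuler t ht.le,
      h.euler_equation hP hγ heq ht, hcaputo α hP.lt_one t ht]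
    simp only [hcaputo _ (hP.lower_lt_one _) t ht]
  · have hneg := h.mul_exponent.eventually_neg (i₀ := i₀) (fun i hi => hγ₀ ▸ hi₀ i hi)
      (mul_neg_of_neg_of_pos ha (hγ₀ ▸ hP.pos))
    filter_upwards [hneg, self_mem_nhdsWithin] with t ht (ht₀ : 0 < t)
    rwa [← heuler t ht₀.le]

end IsEntireRpowSeries

theorem IsRelaxation.congr {y y' : ℝ → ℝ} (h : IsRelaxation α αs b lam y)
    (hy : EqOn y y' (Ici 0)) : IsRelaxation α αs b lam y' := by
  have hpos : ∀ t : ℝ, EqOn y y' (Ioo 0 t) := fun _ => hy.mono fun _ hs => hs.1.le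
  have hderiv : ∀ t, 0 ≤ t → t * deriv y t = t * deriv y' t := fun t ht => by
    rcases ht.eq_or_lt with rfl | ht
    · simp only [zero_mul]
    · exact congrArg (t * ·) (hy.eventuallyEq_of_mem (Ici_mem_nhds ht)).deriv_eq
  refine ⟨h.regular.congr hy, ?_, fun t ht => ?_, h.euler_regular.congr fun t ht => hderiv t ht,
    fun t ht => ?_, ?_⟩
  · rw [← hy self_mem_Ici, h.apply_zero]
  · rw [← multiTermDeriv_congr ht.le (hpos t), ← hy ht.le, h.equation t ht]
  · simp only [← caputoDeriv_congr ht.le (hpos t)]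
    rw [← multiTermDeriv_congr ht.le fun s hs => hderiv s hs.1.le, ← hderiv t ht.le,
      h.euler_equation t ht]
  · filter_upwards [h.euler_eventually_neg, self_mem_nhdsWithin] with t ht (ht₀ : 0 < t)
    rwa [← hderiv t ht₀.le]

/-- The vector `(α, α - α₁, …, α - αₘ)` of orders in the solution representation. -/
noncomputable def modeOrders (α : ℝ) (αs : Fin m → ℝ) : Fin (m + 1) → ℝ :=
  Fin.cons α fun i => α - αs i

/-- The coefficients of the powers of `t` in the arguments `(-λ t^α, -b₁ t^{α-α₁}, …)` of the
Mittag-Leffler function in `modeFactor`. -/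
noncomputable def modeArgs (b : Fin m → ℝ) (lam : ℝ) : Fin (m + 1) → ℝ :=
  Fin.cons (-lam) fun i => -b i

theorem modeOrders_pos (hP : AdmissibleOrders α αs b) (i : Fin (m + 1)) :
    0 < modeOrders α αs i := by
  refine Fin.cases ?_ (fun j => ?_) i
  · simpa only [modeOrders, Fin.cons_zero] using hP.pos
  · simpa only [modeOrders, Fin.cons_succ, sub_pos] using hP.lower_lt j

theorem modeFactor_eq (hP : AdmissibleOrders α αs b) (ht : 0 ≤ t) :
    modeFactor α αs b lam t
      = 1 + -lam * mlSeries (modeOrders α αs) (modeArgs b lam) α t := by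
  have hpos := modeOrders_pos hP
  rcases ht.eq_or_lt with rfl | ht
  · rw [mlSeries, rpowSeries_zero fun l => hP.pos.trans_le
      (le_mlExponent (fun i => (hpos i).le) α l)]
    simp [modeFactor, Real.zero_rpow hP.pos.ne']
  · have hargs : (Fin.cons (-(lam * t ^ α)) (fun i => -(b i * t ^ (α - αs i))) : Fin (m + 1) → ℝ)
        = fun i => modeArgs b lam i * t ^ modeOrders α αs i := by
      funext i
      refine Fin.cases ?_ (fun j => ?_) i <;> simp [modeArgs, modeOrders]
    rw [← rpow_mul_multinomialML hpos (modeArgs b lam) hP.pos.le ht, modeFactor, hargs, modeOrders]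
    ring

theorem multiTermDeriv_mlSeries (hP : AdmissibleOrders α αs b) (ht : 0 < t) :
    multiTermDeriv α αs b (mlSeries (modeOrders α αs) (modeArgs b lam) α) t
      = 1 - lam * mlSeries (modeOrders α αs) (modeArgs b lam) α t := by
  have hpos := modeOrders_pos hP
  have hzero := mlSeries_zero_eq_one_add hpos (modeArgs b lam) ht
  simp only [Fin.sum_univ_succ, modeOrders, modeArgs, Fin.cons_zero, Fin.cons_succ, neg_mul,
    Finset.sum_neg_distrib] at hzero
  simp only [multiTermDeriv, caputoDeriv_mlSeries hpos _ hP.pos hP.lt_one ht, sub_self,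
    caputoDeriv_mlSeries hpos _ hP.pos (hP.lower_lt_one _) ht, smul_eq_mul]
  simp only [modeOrders, modeArgs]
  rw [hzero]
  ring

theorem isRelaxation_modeFactor (hP : AdmissibleOrders α αs b) (hlam : 0 < lam) :
    IsRelaxation α αs b lam (modeFactor α αs b lam) := by
  have hpos := modeOrders_pos hP
  have hentire := (isEntireRpowSeries_mlSeries hpos (modeArgs b lam) hP.pos.le).const_mul (-lam)
  have hfactor : ∀ t, 0 ≤ t → 1 + rpowSeries (fun l => -lam * mlCoeff (modeOrders α αs)
      (modeArgs b lam) α l) (mlExponent (modeOrders α αs) α) t = modeFactor α αs b lam t :=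
    fun t ht => by rw [rpowSeries_const_mul, modeFactor_eq hP ht, mlSeries]
  refine (hentire.isRelaxation hP mlExponent_zero (fun l hl => lt_mlExponent hpos α hl) ?_
    fun t ht => ?_).congr fun t ht => hfactor t ht
  · rw [mlCoeff, multinomialCoeff_zero, mlExponent_zero]
    exact mul_neg_of_neg_of_pos (neg_neg_of_pos hlam)
      (one_div_pos.2 (Real.Gamma_pos_of_pos (by linarith [hP.pos])))
  · have hseries : (rpowSeries (fun l => -lam * mlCoeff (modeOrders α αs) (modeArgs b lam) α l)
        (mlExponent (modeOrders α αs) α))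
        = fun t => -lam • mlSeries (modeOrders α αs) (modeArgs b lam) α t :=
      funext fun t => rpowSeries_const_mul ..
    rw [hseries, multiTermDeriv_const_smul, multiTermDeriv_mlSeries hP ht]
    simp only [smul_eq_mul]
    ring

end Mode

/-! ### The Poincaré inequality -/

section Poincare

section Direction

variable {E : Type*} [NormedAddCommGroup E] [NormedSpace ℝ E] [MeasurableSpace E] [BorelSpace E]
  {μ : Measure E} {ψ : E → ℝ} {L : E →L[ℝ] ℝ} {v : E}

section Integrable

variable [IsFiniteMeasureOnCompacts μ]

theorem integrable_sq_of_contDiff (hψ : ContDiff ℝ 1 ψ) (hc : HasCompactSupport ψ) :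
    Integrable (fun x => ψ x ^ 2) μ := by
  have hsupp : HasCompactSupport fun x => ψ x ^ 2 :=
    hc.comp_left (g := fun y : ℝ => y ^ 2) (by simp)
  exact (hψ.continuous.pow 2).integrable_of_hasCompactSupport hsupp

theorem integrable_mul_fderiv_mul (hψ : ContDiff ℝ 1 ψ) (hc : HasCompactSupport ψ) :
    Integrable (fun x => 2 * ψ x * fderiv ℝ ψ x v * L x) μ := by
  have hψ' : Continuous fun x => fderiv ℝ ψ x v :=
    (hψ.continuous_fderiv one_ne_zero).clm_apply continuous_const
  have hsupp : HasCompactSupport fun x => 2 * ψ x := hc.mul_left (f := fun _ => 2)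
  exact (((continuous_const.mul hψ.continuous).mul hψ').mul L.continuous)
    |>.integrable_of_hasCompactSupport hsupp.mul_right.mul_right

theorem integrable_norm_fderiv_sq (hψ : ContDiff ℝ 1 ψ) (hc : HasCompactSupport ψ) :
    Integrable (fun x => ‖fderiv ℝ ψ x‖ ^ 2) μ := by
  have hsupp : HasCompactSupport fun x => ‖fderiv ℝ ψ x‖ ^ 2 :=
    (hc.fderiv ℝ).comp_left (g := fun y : E →L[ℝ] ℝ => ‖y‖ ^ 2) (by simp)
  exact ((hψ.continuous_fderiv one_ne_zero).norm.pow 2).integrable_of_hasCompactSupport hsupp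

theorem integrable_fderiv_apply_sq (hψ : ContDiff ℝ 1 ψ) (hc : HasCompactSupport ψ) :
    Integrable (fun x => fderiv ℝ ψ x v ^ 2) μ := by
  have hψ' : Continuous fun x => fderiv ℝ ψ x v :=
    (hψ.continuous_fderiv one_ne_zero).clm_apply continuous_const
  have hsupp : HasCompactSupport fun x => fderiv ℝ ψ x v ^ 2 :=
    (hc.fderiv ℝ).comp_left (g := fun y : E →L[ℝ] ℝ => y v ^ 2) (by simp)
  exact (hψ'.pow 2).integrable_of_hasCompactSupport hsupp

end Integrable

variable [FiniteDimensional ℝ E] [μ.IsAddHaarMeasure]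

theorem integral_sq_eq_integral_mul_fderiv (hψ : ContDiff ℝ 1 ψ) (hc : HasCompactSupport ψ)
    (hL : L v = 1) : ∫ x, ψ x ^ 2 ∂μ = ∫ x, -(2 * ψ x * fderiv ℝ ψ x v * L x) ∂μ := by
  have hderiv : ∀ x, fderiv ℝ (fun y => ψ y ^ 2) x v = 2 * ψ x * fderiv ℝ ψ x v := fun x => by
    simp [((hψ.differentiable one_ne_zero x).hasFDerivAt.pow 2).fderiv]
  have hLv : ∀ x, fderiv ℝ L x v = 1 := fun x => by rw [L.fderiv, hL]
  have hsq : HasCompactSupport fun x => ψ x ^ 2 :=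
    hc.comp_left (g := fun y : ℝ => y ^ 2) (by simp)
  have hparts := integral_mul_fderiv_eq_neg_fderiv_mul_of_integrable (μ := μ) (v := v)
    (f := fun x => ψ x ^ 2) (g := L)
    (by simpa only [hderiv] using integrable_mul_fderiv_mul hψ hc)
    (by simpa only [hLv, mul_one] using integrable_sq_of_contDiff hψ hc)
    (((hψ.continuous.pow 2).mul L.continuous).integrable_of_hasCompactSupport hsq.mul_right)
    (fun x _ => (hψ.differentiable one_ne_zero x).pow 2) (fun x _ => L.differentiableAt)
  simp only [hLv, mul_one, hderiv] at hparts
  rw [hparts, integral_neg]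

theorem integral_sq_le_integral_fderiv_sq (hψ : ContDiff ℝ 1 ψ) (hc : HasCompactSupport ψ)
    (hL : L v = 1) {R : ℝ} (hR : ∀ x, ψ x ≠ 0 → |L x| ≤ R) :
    ∫ x, ψ x ^ 2 ∂μ ≤ 4 * R ^ 2 * ∫ x, fderiv ℝ ψ x v ^ 2 ∂μ := by
  have hint := integrable_sq_of_contDiff (μ := μ) hψ hc
  have hint' := integrable_fderiv_apply_sq (μ := μ) (v := v) hψ hc
  have hpoint : ∀ x, -(2 * ψ x * fderiv ℝ ψ x v * L x)
      ≤ 1 / 2 * ψ x ^ 2 + 2 * R ^ 2 * fderiv ℝ ψ x v ^ 2 := fun x => by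
    rcases eq_or_ne (ψ x) 0 with hx | hx
    · simp only [hx, mul_zero, zero_mul, neg_zero]
      positivity
    · have hLR : L x ^ 2 ≤ R ^ 2 := sq_le_sq' (abs_le.1 (hR x hx)).1 (abs_le.1 (hR x hx)).2
      nlinarith [sq_nonneg (ψ x + 2 * (fderiv ℝ ψ x v * L x)),
        mul_le_mul_of_nonneg_left hLR (sq_nonneg (fderiv ℝ ψ x v))]
  have hbound : ∫ x, ψ x ^ 2 ∂μ
      ≤ ∫ x, (1 / 2 * ψ x ^ 2 + 2 * R ^ 2 * fderiv ℝ ψ x v ^ 2) ∂μ := by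
    rw [integral_sq_eq_integral_mul_fderiv hψ hc hL]
    exact integral_mono (integrable_mul_fderiv_mul hψ hc).neg
      ((hint.const_mul _).add (hint'.const_mul _)) hpoint
  rw [integral_add (hint.const_mul _) (hint'.const_mul _), integral_const_mul, integral_const_mul]
    at hbound
  linarith

end Direction

theorem integral_sq_le_integral_norm_gradient_sq {E : Type*} [NormedAddCommGroup E]
    [InnerProductSpace ℝ E] [FiniteDimensional ℝ E] [Nontrivial E] [MeasurableSpace E]
    [BorelSpace E] {μ : Measure E} [μ.IsAddHaarMeasure] {ψ : E → ℝ} (hψ : ContDiff ℝ 1 ψ)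
    (hc : HasCompactSupport ψ) {R : ℝ} (hR : ∀ x, ψ x ≠ 0 → ‖x‖ ≤ R) :
    ∫ x, ψ x ^ 2 ∂μ ≤ 4 * R ^ 2 * ∫ x, ‖gradient ψ x‖ ^ 2 ∂μ := by
  obtain ⟨v, hv⟩ := exists_norm_eq E zero_le_one
  have hnorm : ∀ x, ‖gradient ψ x‖ = ‖fderiv ℝ ψ x‖ := fun x => by
    rw [← toDual_gradient, LinearIsometryEquiv.norm_map]
  have hslope : ∀ x, fderiv ℝ ψ x v ^ 2 ≤ ‖fderiv ℝ ψ x‖ ^ 2 := fun x => by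
    have hle : |fderiv ℝ ψ x v| ≤ ‖fderiv ℝ ψ x‖ := by simpa [hv] using (fderiv ℝ ψ x).le_opNorm v
    exact sq_le_sq' (abs_le.1 hle).1 (abs_le.1 hle).2
  have hdirection : ∫ x, ψ x ^ 2 ∂μ ≤ 4 * R ^ 2 * ∫ x, fderiv ℝ ψ x v ^ 2 ∂μ := by
    refine integral_sq_le_integral_fderiv_sq hψ hc (L := innerSL ℝ v) ?_ fun x hx => ?_
    · rw [innerSL_apply_apply, real_inner_self_eq_norm_sq, hv, one_pow]
    · simpa [hv] using (abs_real_inner_le_norm v x).trans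
        (mul_le_mul_of_nonneg_left (hR x hx) (norm_nonneg v))
  simp only [hnorm]
  exact hdirection.trans (mul_le_mul_of_nonneg_left (integral_mono
    (integrable_fderiv_apply_sq hψ hc) (integrable_norm_fderiv_sq hψ hc) hslope) (by positivity))

theorem norm_sq_eq_integral_of_ae_eq {X F : Type*} [MeasurableSpace X] [NormedAddCommGroup F]
    [InnerProductSpace ℝ F] {μ : Measure X} {Ω : Set X} {f : Lp F 2 (μ.restrict Ω)} {g : X → F}
    (hf : f =ᵐ[μ.restrict Ω] g) (hg : ∀ x ∉ Ω, g x = 0) : ‖f‖ ^ 2 = ∫ x, ‖g x‖ ^ 2 ∂μ := by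
  rw [← real_inner_self_eq_norm_sq, L2.inner_def,
    ← setIntegral_eq_integral_of_forall_compl_eq_zero (s := Ω) (f := fun x => ‖g x‖ ^ 2)
      fun x hx => by simp [hg x hx]]
  exact integral_congr_ae (hf.mono fun x hx => by simp only [hx, real_inner_self_eq_norm_sq])

variable {d : ℕ} {Ω : Set (EuclideanSpace ℝ (Fin d))}

theorem IsConvexPolygonalDomain.isBounded (h : IsConvexPolygonalDomain Ω) :
    Bornology.IsBounded Ω := by
  obtain ⟨-, S, hS, rfl⟩ := h
  exact (isBounded_convexHull.2 hS.isBounded).subset interior_subset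

theorem mem_testGraph_of_mem_span {w : WithLp 2 (L2 Ω × L2Vec Ω)}
    (hw : w ∈ Submodule.span ℝ (testGraph Ω)) : w ∈ testGraph Ω := by
  induction hw using Submodule.span_induction with
  | mem _ hw => exact hw
  | zero =>
    refine ⟨0, contDiff_const, HasCompactSupport.zero, by simp [tsupport], Lp.coeFn_zero .., ?_⟩
    filter_upwards [Lp.coeFn_zero (EuclideanSpace ℝ (Fin d)) 2 (volume.restrict Ω)] with x hx
    exact hx.trans (by simp [gradient])
  | add w₁ w₂ _ _ h₁ h₂ =>
    obtain ⟨ψ₁, hd₁, hc₁, hs₁, hf₁, hg₁⟩ := h₁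
    obtain ⟨ψ₂, hd₂, hc₂, hs₂, hf₂, hg₂⟩ := h₂
    refine ⟨ψ₁ + ψ₂, hd₁.add hd₂, hc₁.add hc₂, (tsupport_add ψ₁ ψ₂).trans (union_subset hs₁ hs₂),
      (Lp.coeFn_add _ _).trans (hf₁.add hf₂), ?_⟩
    filter_upwards [(Lp.coeFn_add w₁.snd w₂.snd).trans (hg₁.add hg₂)] with x hx
    refine hx.trans ?_
    simp only [Pi.add_apply, gradient]
    rw [fderiv_add (hd₁.differentiable (by simp) x) (hd₂.differentiable (by simp) x), map_add]
  | smul c w _ h =>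
    obtain ⟨ψ, hd, hc, hs, hf, hg⟩ := h
    refine ⟨c • ψ, contDiff_const.smul hd, hc.smul_left (f := fun _ => c),
      (tsupport_smul_subset_right (fun _ => c) ψ).trans hs,
      (Lp.coeFn_smul _ _).trans (hf.const_smul c), ?_⟩
    filter_upwards [(Lp.coeFn_smul c w.snd).trans (hg.const_smul c)] with x hx
    refine hx.trans ?_
    simp only [Pi.smul_apply, gradient]
    rw [fderiv_const_smul (hd.differentiable (by simp) x), map_smul]

theorem exists_norm_toL2_le (hd : 1 ≤ d) (hΩ : Bornology.IsBounded Ω) :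
    ∃ K : ℝ, ∀ w : H10 Ω, ‖toL2 Ω w‖ ≤ K * ‖grad Ω w‖ := by
  obtain ⟨R, hR₀, hR⟩ := hΩ.exists_pos_norm_le
  have : Nonempty (Fin d) := ⟨⟨0, hd⟩⟩
  refine ⟨2 * R, fun w => ?_⟩
  have hclosed : IsClosed {w : WithLp 2 (L2 Ω × L2Vec Ω) | ‖w.fst‖ ≤ 2 * R * ‖w.snd‖} :=
    isClosed_le (WithLp.fstL 2 ℝ (L2 Ω) (L2Vec Ω)).continuous.norm
      (continuous_const.mul (WithLp.sndL 2 ℝ (L2 Ω) (L2Vec Ω)).continuous.norm)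
  refine closure_minimal (fun w hw => ?_) hclosed w.2
  obtain ⟨ψ, hψ, hc, hs, hf, hg⟩ := mem_testGraph_of_mem_span hw
  have hψ_zero : ∀ x ∉ Ω, ψ x = 0 := fun x hx => image_eq_zero_of_notMem_tsupport fun h => hx (hs h)
  have hgrad_zero : ∀ x ∉ Ω, gradient ψ x = 0 := fun x hx => by
    have : fderiv ℝ ψ x = 0 :=
      image_eq_zero_of_notMem_tsupport fun h => hx (hs (tsupport_fderiv_subset ℝ h))
    simp [gradient, this]
  have hpoincare : ‖w.fst‖ ^ 2 ≤ (2 * R * ‖w.snd‖) ^ 2 := by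
    have := integral_sq_le_integral_norm_gradient_sq (μ := volume) (hψ.of_le (by simp)) hc
      fun x hx => hR x (hs (subset_tsupport ψ hx))
    rw [norm_sq_eq_integral_of_ae_eq hf hψ_zero, mul_pow,
      norm_sq_eq_integral_of_ae_eq hg hgrad_zero]
    simp only [Real.norm_eq_abs, sq_abs]
    linarith
  exact (pow_le_pow_iff_left₀ (norm_nonneg _) (by positivity) two_ne_zero).1 hpoincare

end Poincare

/-! ### Eigenfunctions in `H¹₀(Ω)` -/

section Riesz

variable {d : ℕ} {Ω : Set (EuclideanSpace ℝ (Fin d))}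

theorem inner_H10 (w χ : H10 Ω) :
    ⟪w, χ⟫ = ⟪toL2 Ω w, toL2 Ω χ⟫ + ⟪grad Ω w, grad Ω χ⟫ :=
  WithLp.prod_inner_apply _ _

theorem toDual_H10 (w : H10 Ω) :
    InnerProductSpace.toDual ℝ (H10 Ω) w = embed w - laplacian w := by
  ext χ
  rw [InnerProductSpace.toDual_apply_apply, inner_H10]
  simp [embed, laplacian]

namespace IsDirichletEigenpair

variable {μ : ℝ} {w : H10 Ω}

theorem inner_grad (h : IsDirichletEigenpair μ w) (χ : H10 Ω) :
    ⟪grad Ω w, grad Ω χ⟫ = μ * ⟪toL2 Ω w, toL2 Ω χ⟫ := by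
  simpa [embed, laplacian] using congrArg (fun f : HNegOne Ω => f χ) h.2

theorem toDual_eq (h : IsDirichletEigenpair μ w) :
    InnerProductSpace.toDual ℝ (H10 Ω) w = (1 + μ) • embed w := by
  rw [toDual_H10, sub_eq_add_neg, h.2, add_smul, one_smul]

theorem pos (hd : 1 ≤ d) (hΩ : Bornology.IsBounded Ω) (h : IsDirichletEigenpair μ w) : 0 < μ := by
  obtain ⟨K, hK⟩ := exists_norm_toL2_le hd hΩ
  have hgrad := h.inner_grad w
  simp only [real_inner_self_eq_norm_sq] at hgrad
  by_contra! hμ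
  have hgrad_zero : ‖grad Ω w‖ = 0 := by
    nlinarith [mul_nonpos_of_nonpos_of_nonneg hμ (sq_nonneg ‖toL2 Ω w‖), norm_nonneg (grad Ω w)]
  have htoL2_zero : ‖toL2 Ω w‖ = 0 :=
    le_antisymm (by simpa only [hgrad_zero, mul_zero] using hK w) (norm_nonneg _)
  apply h.1
  rw [← inner_self_eq_zero (𝕜 := ℝ), inner_H10, real_inner_self_eq_norm_sq,
    real_inner_self_eq_norm_sq, hgrad_zero, htoL2_zero]
  norm_num

end IsDirichletEigenpair

namespace IsDirichletEigensystem

variable {lam : ℕ → ℝ} {φ : ℕ → H10 Ω}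

theorem inner_eq (h : IsDirichletEigensystem Ω lam φ) (i j : ℕ) :
    ⟪φ i, φ j⟫ = if i = j then 1 + lam i else 0 := by
  rw [inner_H10, (h.eigenpair i).inner_grad, orthonormal_iff_ite.1 h.orthonormal i j]
  split_ifs <;> ring

end IsDirichletEigensystem

/-- The eigenfunctions, normalized in `H¹₀(Ω)`. -/
noncomputable def unitEigenfunction (lam : ℕ → ℝ) (φ : ℕ → H10 Ω) (j : ℕ) : H10 Ω :=
  (Real.sqrt (1 + lam j))⁻¹ • φ j

theorem IsDirichletEigensystem.orthonormal_unitEigenfunction {lam : ℕ → ℝ} {φ : ℕ → H10 Ω}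
    (h : IsDirichletEigensystem Ω lam φ) (hlam : ∀ j, 0 < lam j) :
    Orthonormal ℝ (unitEigenfunction lam φ) := by
  rw [orthonormal_iff_ite]
  intro i j
  have hpos : 0 < 1 + lam i := by linarith [hlam i]
  calc ⟪unitEigenfunction lam φ i, unitEigenfunction lam φ j⟫
      = (Real.sqrt (1 + lam i))⁻¹ * ((Real.sqrt (1 + lam j))⁻¹ * ⟪φ i, φ j⟫) :=
        (real_inner_smul_left (F := H10 Ω) _ _ _).trans
          (congrArg _ (real_inner_smul_right (F := H10 Ω) _ _ _))
    _ = if i = j then 1 else 0 := by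
        rw [h.inner_eq]
        split_ifs with hij
        · subst hij
          rw [← mul_assoc, ← mul_inv, Real.mul_self_sqrt hpos.le, inv_mul_cancel₀ hpos.ne']
        · rw [mul_zero, mul_zero]

end Riesz

/-! ### Calculus in `ℓ²` -/

section EllTwo

open scoped lp

variable {ι : Type*}

theorem memℓp_two_iff {f : ι → ℝ} : Memℓp f 2 ↔ Summable fun j => f j ^ 2 := by
  rw [memℓp_gen_iff (by norm_num)]
  simp

theorem norm_sq_eq_tsum (x : ℓ²(ι, ℝ)) : ‖x‖ ^ 2 = ∑' j, x j ^ 2 := by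
  simpa using lp.norm_rpow_eq_tsum (p := 2) (by norm_num) x

theorem norm_le_norm_of_abs_le {x B : ℓ²(ι, ℝ)} (h : ∀ j, |x j| ≤ B j) : ‖x‖ ≤ ‖B‖ := by
  refine (pow_le_pow_iff_left₀ (norm_nonneg x) (norm_nonneg B) two_ne_zero).1 ?_
  rw [norm_sq_eq_tsum, norm_sq_eq_tsum]
  exact (memℓp_two_iff.1 x.2).tsum_le_tsum
    (fun j => sq_le_sq' (abs_le.1 (h j)).1 (abs_le.1 (h j)).2) (memℓp_two_iff.1 B.2)

theorem exists_forall_eq_of_abs_le {f : ι → ℝ} {B : ℓ²(ι, ℝ)} (h : ∀ j, |f j| ≤ B j) :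
    ∃ x : ℓ²(ι, ℝ), ∀ j, x j = f j :=
  ⟨⟨f, memℓp_two_iff.2 <| .of_nonneg_of_le (fun _ => sq_nonneg _)
    (fun j => sq_le_sq' (abs_le.1 (h j)).1 (abs_le.1 (h j)).2) (memℓp_two_iff.1 B.2)⟩,
    fun _ => rfl⟩

theorem tendsto_of_tendsto_coord {β : Type*} {l : Filter β} {x : β → ℓ²(ι, ℝ)} {y B : ℓ²(ι, ℝ)}
    (hx : ∀ j, Tendsto (fun s => x s j) l (𝓝 (y j))) (hB : ∀ᶠ s in l, ∀ j, |x s j| ≤ B j) :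
    Tendsto x l (𝓝 y) := by
  have hbound : Summable fun j => (B j + |y j|) ^ 2 :=
    memℓp_two_iff.1 ((lp.memℓp B).add (lp.memℓp y).norm)
  have hsq : Tendsto (fun s => ∑' j, (x s - y) j ^ 2) l (𝓝 (∑' _ : ι, (0 : ℝ))) := by
    refine tendsto_tsum_of_dominated_convergence hbound (fun j => ?_) ?_
    · simpa using ((hx j).sub_const (y j)).pow 2
    · filter_upwards [hB] with s hs j
      rw [norm_pow, Real.norm_eq_abs]
      exact pow_le_pow_left₀ (abs_nonneg _) ((abs_sub _ _).trans (by linarith [hs j])) 2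
  simp only [← norm_sq_eq_tsum, tsum_zero] at hsq
  rw [tendsto_iff_norm_sub_tendsto_zero]
  simpa only [Real.sqrt_sq (norm_nonneg _), Real.sqrt_zero] using hsq.sqrt

theorem hasDerivAt_of_abs_deriv_coord_le {x : ℝ → ℓ²(ι, ℝ)} {x' B : ℓ²(ι, ℝ)} {s : Set ℝ} {t : ℝ}
    (hs : s ∈ 𝓝 t) (hconv : Convex ℝ s)
    (hx : ∀ r ∈ s, ∀ j, DifferentiableAt ℝ (fun τ => x τ j) r)
    (hB : ∀ r ∈ s, ∀ j, |deriv (fun τ => x τ j) r| ≤ B j)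
    (hx' : ∀ j, x' j = deriv (fun τ => x τ j) t) : HasDerivAt x x' t := by
  have hts : t ∈ s := mem_of_mem_nhds hs
  have hcoord : ∀ r j, slope x t r j = slope (fun τ => x τ j) t r := fun _ _ => rfl
  rw [hasDerivAt_iff_tendsto_slope]
  refine tendsto_of_tendsto_coord (B := B) (fun j => ?_) ?_
  · simpa only [hcoord, hx'] using hasDerivAt_iff_tendsto_slope.1 (hx t hts j).hasDerivAt
  · filter_upwards [mem_nhdsWithin_of_mem_nhds hs] with r hr j
    have hmean := hconv.norm_image_sub_le_of_norm_deriv_le (fun r hr => hx r hr j)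
      (fun r hr => hB r hr j) hts hr
    rw [hcoord, slope_def_field, abs_div]
    exact div_le_of_le_mul₀ (abs_nonneg _) ((abs_nonneg _).trans (hB t hts j)) hmean

/-- Curves in `ℓ²` whose coordinates are differentiable on `(0, ∞)`, with derivatives dominated by
`t^{κ-1}` times a fixed element of `ℓ²`; they have Caputo derivatives of all orders below `1`. -/
structure HasRpowDominatedDeriv (x : ℝ → ℓ²(ι, ℝ)) (B : ℓ²(ι, ℝ)) (κ : ℝ) : Prop where
  pos : 0 < κ
  differentiableAt_coord : ∀ t, 0 < t → ∀ j, DifferentiableAt ℝ (fun τ => x τ j) t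
  abs_deriv_coord_le : ∀ t, 0 < t → ∀ j, |deriv (fun τ => x τ j) t| ≤ t ^ (κ - 1) * B j

namespace HasRpowDominatedDeriv

variable {x : ℝ → ℓ²(ι, ℝ)} {B : ℓ²(ι, ℝ)} {κ t : ℝ}

theorem differentiableAt (h : HasRpowDominatedDeriv x B κ) (ht : 0 < t) :
    DifferentiableAt ℝ x t := by
  have hpos : ∀ r ∈ Icc (t / 2) (2 * t), 0 < r := fun r hr => (half_pos ht).trans_le hr.1
  obtain ⟨K, hK⟩ := isCompact_Icc.exists_bound_of_continuousOn (s := Icc (t / 2) (2 * t))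
    (continuousOn_id.rpow_const (p := κ - 1) fun r hr => Or.inl (hpos r hr).ne')
  obtain ⟨x', hx'⟩ := exists_forall_eq_of_abs_le (B := t ^ (κ - 1) • B) (h.abs_deriv_coord_le t ht)
  have hB : ∀ j, 0 ≤ B j := fun j => by
    simpa using (abs_nonneg _).trans (h.abs_deriv_coord_le 1 one_pos j)
  refine (hasDerivAt_of_abs_deriv_coord_le (B := K • B)
    (Icc_mem_nhds (half_lt_self ht) (lt_two_mul_self ht)) (convex_Icc _ _)
    (fun r hr => h.differentiableAt_coord r (hpos r hr)) (fun r hr j => ?_) hx').differentiableAt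
  exact (h.abs_deriv_coord_le r (hpos r hr) j).trans
    (mul_le_mul_of_nonneg_right ((le_abs_self _).trans (hK r hr)) (hB j))

theorem norm_deriv_le (h : HasRpowDominatedDeriv x B κ) (ht : 0 < t) :
    ‖deriv x t‖ ≤ ‖B‖ * t ^ (κ - 1) := by
  have hcoord : ∀ j, deriv (fun τ => x τ j) t = deriv x t j := fun j =>
    ((lp.evalCLM ℝ (fun _ : ι => ℝ) 2 j).hasFDerivAt.comp_hasDerivAt t
      (h.differentiableAt ht).hasDerivAt).deriv
  have hle := norm_le_norm_of_abs_le (x := deriv x t) (B := t ^ (κ - 1) • B) fun j =>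
    hcoord j ▸ h.abs_deriv_coord_le t ht j
  rwa [norm_smul, Real.norm_of_nonneg (Real.rpow_nonneg ht.le _), mul_comm] at hle

theorem caputoDifferentiableAt (h : HasRpowDominatedDeriv x B κ) {β : ℝ} (hβ : β < 1)
    (ht : 0 < t) : CaputoDifferentiableAt β x t :=
  .of_norm_deriv_le hβ h.pos ht (fun _ hτ => h.differentiableAt hτ.1)
    fun _ hτ => h.norm_deriv_le hτ.1

theorem multiTermDeriv_coord (h : HasRpowDominatedDeriv x B κ) {m : ℕ} {α : ℝ} {αs b : Fin m → ℝ}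
    (hα : α < 1) (hαs : ∀ i, αs i < 1) (ht : 0 < t) (j : ι) :
    multiTermDeriv α αs b x t j = multiTermDeriv α αs b (fun τ => x τ j) t :=
  (multiTermDeriv_clm_comp (h.caputoDifferentiableAt hα ht)
    (fun i => h.caputoDifferentiableAt (hαs i) ht)
    (lp.evalCLM ℝ (fun _ : ι => ℝ) 2 j) ht.le).symm

end HasRpowDominatedDeriv

end EllTwo

/-! ### Orthonormal series in the dual of a Hilbert space -/

section Dual

open scoped lp

variable {H : Type*} [NormedAddCommGroup H] [InnerProductSpace ℝ H] [CompleteSpace H]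
  {ι : Type*} {e : ι → H}

/-- The map `x ↦ ∑ⱼ xⱼ ⟨eⱼ, ·⟩` from `ℓ²` to the dual of a Hilbert space with orthonormal family
`(eⱼ)`. -/
noncomputable def dualSeries (he : Orthonormal ℝ e) : ℓ²(ι, ℝ) →L[ℝ] StrongDual ℝ H where
  toFun x := InnerProductSpace.toDual ℝ H (he.orthogonalFamily.linearIsometry x)
  map_add' x y := by simp only [map_add]
  map_smul' c x := by simp
  cont := (InnerProductSpace.toDual ℝ H).continuous.comp
    he.orthogonalFamily.linearIsometry.continuous

theorem hasSum_dualSeries (he : Orthonormal ℝ e) (x : ℓ²(ι, ℝ)) :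
    HasSum (fun j => x j • InnerProductSpace.toDual ℝ H (e j)) (dualSeries he x) := by
  refine (((he.orthogonalFamily.hasSum_linearIsometry x).map (InnerProductSpace.toDual ℝ H)
    (InnerProductSpace.toDual ℝ H).continuous)).congr_fun fun j => ?_
  simp

theorem dualSeries_apply (he : Orthonormal ℝ e) (x : ℓ²(ι, ℝ)) (j : ι) :
    dualSeries he x (e j) = x j := by
  classical
  refine ((hasSum_dualSeries he x).mapL (ContinuousLinearMap.apply ℝ ℝ (e j))).unique ?_
  refine (hasSum_ite_eq j (x j)).congr_fun fun i => ?_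
  obtain rfl | hij := eq_or_ne i j <;> simp [orthonormal_iff_ite.1 he i, he.1 i, *]

theorem apply_linearIsometry_eq_dualSeries (he : Orthonormal ℝ e) {A : H → StrongDual ℝ H}
    (hA : ∀ w χ, A w χ = A χ w) {a : ι → ℝ}
    (ha : ∀ j, A (e j) = a j • InnerProductSpace.toDual ℝ H (e j)) {x y : ℓ²(ι, ℝ)}
    (hxy : ∀ j, y j = x j * a j) :
    A (he.orthogonalFamily.linearIsometry x) = dualSeries he y := by
  ext χ
  have hχ : ∀ j, A χ (e j) = a j * ⟪e j, χ⟫ := fun j => by rw [hA, ha]; simp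
  rw [hA]
  refine ((he.orthogonalFamily.hasSum_linearIsometry x).mapL (A χ)).unique ?_
  refine ((hasSum_dualSeries he y).mapL (ContinuousLinearMap.apply ℝ ℝ χ)).congr_fun fun j => ?_
  simp [hχ, hxy, mul_assoc]

theorem summable_apply_sq (he : Orthonormal ℝ e) (f : StrongDual ℝ H) :
    Summable fun j => f (e j) ^ 2 := by
  refine (he.inner_products_summable ((InnerProductSpace.toDual ℝ H).symm f)).congr fun j => ?_
  rw [real_inner_comm, InnerProductSpace.toDual_symm_apply, Real.norm_eq_abs, sq_abs]

end Dual

/-! ### The solution operator -/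

section Eigenexpansion

variable {d : ℕ} {Ω : Set (EuclideanSpace ℝ (Fin d))} {lam : ℕ → ℝ} {φ : ℕ → H10 Ω}

theorem embed_smul (c : ℝ) (w : H10 Ω) : embed (c • w) = c • embed w := by
  ext χ
  simp [embed]

theorem embed_apply_comm (w χ : H10 Ω) : embed w χ = embed χ w := by
  simp [embed, real_inner_comm]

theorem apply_unitEigenfunction (f : HNegOne Ω) (j : ℕ) :
    f (unitEigenfunction lam φ j) = (Real.sqrt (1 + lam j))⁻¹ * f (φ j) :=
  f.map_smul _ _

theorem apply_eigenfunction (hlam : ∀ j, 0 < lam j) (f : HNegOne Ω) (j : ℕ) :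
    f (φ j) = Real.sqrt (1 + lam j) * f (unitEigenfunction lam φ j) := by
  have hpos : 0 < 1 + lam j := by linarith [hlam j]
  rw [apply_unitEigenfunction, mul_inv_cancel_left₀ (Real.sqrt_pos.2 hpos).ne']

theorem sq_apply_eigenfunction (hlam : ∀ j, 0 < lam j) (f : HNegOne Ω) (j : ℕ) :
    f (φ j) ^ 2 = (1 + lam j) * f (unitEigenfunction lam φ j) ^ 2 := by
  rw [apply_eigenfunction hlam, mul_pow, Real.sq_sqrt (by linarith [hlam j])]

theorem IsDirichletEigensystem.embed_unitEigenfunction (h : IsDirichletEigensystem Ω lam φ)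
    (hlam : ∀ j, 0 < lam j) (j : ℕ) :
    embed (unitEigenfunction lam φ j) = (1 + lam j)⁻¹ •
      InnerProductSpace.toDual ℝ (H10 Ω) (unitEigenfunction lam φ j) := by
  have hne : 1 + lam j ≠ 0 := by linarith [hlam j]
  have heigen : embed (φ j) = (1 + lam j)⁻¹ • InnerProductSpace.toDual ℝ (H10 Ω) (φ j) := by
    rw [(h.eigenpair j).toDual_eq, inv_smul_smul₀ hne]
  have htoDual : InnerProductSpace.toDual ℝ (H10 Ω) (unitEigenfunction lam φ j)
      = (Real.sqrt (1 + lam j))⁻¹ • InnerProductSpace.toDual ℝ (H10 Ω) (φ j) := by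
    ext χ
    exact real_inner_smul_left (F := H10 Ω) _ _ _
  rw [htoDual, smul_comm, ← heigen]
  exact embed_smul _ _

theorem IsDirichletEigensystem.apply_smul_embed (h : IsDirichletEigensystem Ω lam φ)
    (hlam : ∀ j, 0 < lam j) (f : HNegOne Ω) (j : ℕ) :
    f (φ j) • embed (φ j) = f (unitEigenfunction lam φ j) •
      InnerProductSpace.toDual ℝ (H10 Ω) (unitEigenfunction lam φ j) := by
  have hne : 1 + lam j ≠ 0 := by linarith [hlam j]
  have hunit : embed (unitEigenfunction lam φ j)
      = (Real.sqrt (1 + lam j))⁻¹ • embed (φ j) := embed_smul _ _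
  have hinv : InnerProductSpace.toDual ℝ (H10 Ω) (unitEigenfunction lam φ j)
      = (1 + lam j) • embed (unitEigenfunction lam φ j) := by
    rw [h.embed_unitEigenfunction hlam, smul_inv_smul₀ hne]
  have hsqrt : Real.sqrt (1 + lam j) ≠ 0 := (Real.sqrt_pos.2 (by linarith [hlam j])).ne'
  rw [hinv, hunit, smul_smul, smul_smul, apply_unitEigenfunction]
  congr 1
  nth_rewrite 2 [← Real.sq_sqrt (show 0 ≤ 1 + lam j by linarith [hlam j])]
  field_simp

theorem memDotH_and_dotHNorm_le {p q K : ℝ} (hlam : ∀ j, 0 < lam j) (hK : 0 ≤ K)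
    {f v : HNegOne Ω} (hv : MemDotH lam φ q v)
    (h : ∀ j, lam j ^ ((p - q) / 2) * |f (φ j)| ≤ K * |v (φ j)|) :
    MemDotH lam φ p f ∧ dotHNorm lam φ p f ≤ K * dotHNorm lam φ q v := by
  have hterm : ∀ j, lam j ^ p * f (φ j) ^ 2 ≤ K ^ 2 * (lam j ^ q * v (φ j) ^ 2) := fun j => by
    have hsplit : lam j ^ p = lam j ^ q * (lam j ^ ((p - q) / 2)) ^ 2 := by
      rw [← Real.rpow_mul_natCast (hlam j).le, ← Real.rpow_add (hlam j)]
      congr 1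
      push_cast
      ring
    calc lam j ^ p * f (φ j) ^ 2
        = lam j ^ q * (lam j ^ ((p - q) / 2) * |f (φ j)|) ^ 2 := by
          rw [hsplit, mul_pow, sq_abs, mul_assoc]
      _ ≤ lam j ^ q * (K * |v (φ j)|) ^ 2 := by
          have hpow := Real.rpow_nonneg (hlam j).le
          exact mul_le_mul_of_nonneg_left (pow_le_pow_left₀
            (mul_nonneg (hpow _) (abs_nonneg _)) (h j) 2) (hpow q)
      _ = K ^ 2 * (lam j ^ q * v (φ j) ^ 2) := by rw [mul_pow, sq_abs]; ring
  have hf : MemDotH lam φ p f := .of_nonneg_of_le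
    (fun j => mul_nonneg (Real.rpow_nonneg (hlam j).le _) (sq_nonneg _)) hterm (hv.mul_left _)
  refine ⟨hf, ?_⟩
  rw [dotHNorm, dotHNorm, ← Real.sqrt_sq hK, ← Real.sqrt_mul (sq_nonneg K), ← tsum_mul_left]
  exact Real.sqrt_le_sqrt (hf.tsum_le_tsum hterm (hv.mul_left _))

theorem tendsto_dotHNorm_zero {β : Type*} {l : Filter β} {q : ℝ} (hlam : ∀ j, 0 < lam j)
    {f : β → HNegOne Ω} {v : HNegOne Ω} (hv : MemDotH lam φ q v)
    (hle : ∀ᶠ s in l, ∀ j, |f s (φ j)| ≤ |v (φ j)|)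
    (hf : ∀ j, Tendsto (fun s => f s (φ j)) l (𝓝 0)) :
    Tendsto (fun s => dotHNorm lam φ q (f s)) l (𝓝 0) := by
  have hsum : Tendsto (fun s => ∑' j, lam j ^ q * f s (φ j) ^ 2) l (𝓝 (∑' _ : ℕ, (0 : ℝ))) := by
    refine tendsto_tsum_of_dominated_convergence hv (fun j => ?_) ?_
    · simpa using ((hf j).pow 2).const_mul (lam j ^ q)
    · filter_upwards [hle] with s hs j
      have hq := Real.rpow_nonneg (hlam j).le q
      rw [Real.norm_of_nonneg (mul_nonneg hq (sq_nonneg _))]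
      exact mul_le_mul_of_nonneg_left (sq_le_sq.2 (hs j)) hq
  simpa [dotHNorm] using hsum.sqrt

theorem rpow_two_mul_le {x θ q : ℝ} (hx : 0 < x) (hθ₀ : 0 ≤ θ) (hθq : 2 * θ ≤ q + 1) :
    x ^ (2 * θ) ≤ 1 + x ^ q * (1 + x) := by
  have hq : 0 ≤ x ^ q := Real.rpow_nonneg hx.le q
  rcases le_total x 1 with hle | hle
  · exact le_add_of_le_of_nonneg (Real.rpow_le_one hx.le hle (by linarith)) (by positivity)
  · calc x ^ (2 * θ) ≤ x ^ (q + 1) := Real.rpow_le_rpow_of_exponent_le hle hθq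
      _ = x ^ q * x := Real.rpow_add_one hx.ne' q
      _ ≤ 1 + x ^ q * (1 + x) := by linarith

theorem MemDotH.summable_rpow_mul_apply_unitEigenfunction_sq {q : ℝ} {v : HNegOne Ω}
    (hv : MemDotH lam φ q v) (h : IsDirichletEigensystem Ω lam φ) (hlam : ∀ j, 0 < lam j) {θ : ℝ}
    (hθ₀ : 0 ≤ θ) (hθq : 2 * θ ≤ q + 1) :
    Summable fun j => (lam j ^ θ * v (unitEigenfunction lam φ j)) ^ 2 := by
  refine .of_nonneg_of_le (fun _ => sq_nonneg _) (fun j => ?_)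
    ((summable_apply_sq (h.orthonormal_unitEigenfunction hlam) v).add hv)
  have hpow : (lam j ^ θ) ^ 2 = lam j ^ (2 * θ) := by
    rw [← Real.rpow_mul_natCast (hlam j).le, mul_comm, Nat.cast_ofNat]
  rw [mul_pow, hpow, sq_apply_eigenfunction (φ := φ) hlam v j]
  linarith [mul_le_mul_of_nonneg_right (rpow_two_mul_le (hlam j) hθ₀ hθq)
    (sq_nonneg (v (unitEigenfunction lam φ j)))]

end Eigenexpansion

/-- The data of the problem: the operator `P(∂ₜ)`, the Dirichlet eigensystem with positive
eigenvalues, and an initial value in `Ḣ^q(Ω)` with `q > -1`. -/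
structure IsDiffusionData {d m : ℕ} {Ω : Set (EuclideanSpace ℝ (Fin d))} (α : ℝ)
    (αs b : Fin m → ℝ) (lam : ℕ → ℝ) (φ : ℕ → H10 Ω) (q : ℝ) (v : HNegOne Ω) : Prop where
  orders : AdmissibleOrders α αs b
  eigensystem : IsDirichletEigensystem Ω lam φ
  lam_pos : ∀ j, 0 < lam j
  neg_one_lt : -1 < q
  memDotH : MemDotH lam φ q v

section Solution

open scoped lp

variable {d m : ℕ} {Ω : Set (EuclideanSpace ℝ (Fin d))} {α : ℝ} {αs b : Fin m → ℝ} {lam : ℕ → ℝ}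
  {φ : ℕ → H10 Ω} {q : ℝ} {v : HNegOne Ω} {t : ℝ}

open Classical in
/-- The coordinates of `E(t)v` in the eigenfunctions normalized in `H¹₀(Ω)`, as a curve in `ℓ²`;
the value is `0` at the irrelevant times (`t < 0`) at which they are not square summable. -/
noncomputable def solCoords (α : ℝ) (αs b : Fin m → ℝ) (lam : ℕ → ℝ) (φ : ℕ → H10 Ω)
    (v : HNegOne Ω) (t : ℝ) : ℓ²(ℕ, ℝ) :=
  if h : Memℓp (fun j => modeFactor α αs b (lam j) t * v (unitEigenfunction lam φ j)) 2
    then ⟨_, h⟩ else 0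

namespace IsDiffusionData

theorem isRelaxation (h : IsDiffusionData α αs b lam φ q v) (j : ℕ) :
    IsRelaxation α αs b (lam j) (modeFactor α αs b (lam j)) :=
  isRelaxation_modeFactor h.orders (h.lam_pos j)

theorem modeFactor_nonneg (h : IsDiffusionData α αs b lam φ q v) (ht : 0 < t) (j : ℕ) :
    0 ≤ modeFactor α αs b (lam j) t :=
  (h.isRelaxation j).nonneg h.orders (h.lam_pos j) ht.le

theorem modeFactor_le_one (h : IsDiffusionData α αs b lam φ q v) (ht : 0 < t) (j : ℕ) :
    modeFactor α αs b (lam j) t ≤ 1 :=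
  (h.isRelaxation j).le_one h.orders (h.lam_pos j).le ht.le

theorem orthonormal (h : IsDiffusionData α αs b lam φ q v) :
    Orthonormal ℝ (unitEigenfunction lam φ) :=
  h.eigensystem.orthonormal_unitEigenfunction h.lam_pos

theorem solCoords_apply (h : IsDiffusionData α αs b lam φ q v) (ht : 0 < t) (j : ℕ) :
    solCoords α αs b lam φ v t j
      = modeFactor α αs b (lam j) t * v (unitEigenfunction lam φ j) := by
  rw [solCoords, dif_pos]
  refine memℓp_two_iff.2 (.of_nonneg_of_le (fun _ => sq_nonneg _) (fun j => ?_)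
    (summable_apply_sq h.orthonormal v))
  rw [mul_pow]
  exact mul_le_of_le_one_left (sq_nonneg _)
    (pow_le_one₀ (h.modeFactor_nonneg ht j) (h.modeFactor_le_one ht j))

theorem exists_hasRpowDominatedDeriv (h : IsDiffusionData α αs b lam φ q v) :
    ∃ B κ, HasRpowDominatedDeriv (solCoords α αs b lam φ v) B κ := by
  -- `λ^θ v ∈ H⁻¹(Ω)` for this `θ`
  set θ := min 1 ((q + 1) / 2)
  have hθ₀ : 0 < θ := lt_min one_pos (by linarith [h.neg_one_lt])
  have hθ₁ : θ ≤ 1 := min_le_left _ _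
  have hθq : 2 * θ ≤ q + 1 := by linarith [min_le_right (1 : ℝ) ((q + 1) / 2)]
  set M := 1 + α / Real.Gamma (α + 1)
  have hB : Memℓp (fun j => M * |lam j ^ θ * v (unitEigenfunction lam φ j)|) 2 := by
    simp only [memℓp_two_iff, mul_pow M, sq_abs]
    exact (h.memDotH.summable_rpow_mul_apply_unitEigenfunction_sq h.eigensystem h.lam_pos
      hθ₀.le hθq).mul_left _
  have hcoord : ∀ t, 0 < t → ∀ j, HasDerivAt (fun τ => solCoords α αs b lam φ v τ j)
      (deriv (modeFactor α αs b (lam j)) t * v (unitEigenfunction lam φ j)) t := fun t ht j => by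
    refine (((h.isRelaxation j).regular.differentiableAt ht).hasDerivAt.mul_const _)
      |>.congr_of_eventuallyEq ?_
    filter_upwards [lt_mem_nhds ht] with τ hτ using h.solCoords_apply hτ j
  refine ⟨⟨_, hB⟩, α * θ, mul_pos h.orders.pos hθ₀, fun t ht j => (hcoord t ht j).differentiableAt,
    fun t ht j => ?_⟩
  calc |deriv (fun τ => solCoords α αs b lam φ v τ j) t|
      = |deriv (modeFactor α αs b (lam j)) t| * |v (unitEigenfunction lam φ j)| := by
        rw [(hcoord t ht j).deriv, abs_mul]
    _ ≤ M * lam j ^ θ * t ^ (α * θ - 1) * |v (unitEigenfunction lam φ j)| := by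
        gcongr
        exact (h.isRelaxation j).abs_deriv_le h.orders (h.lam_pos j) hθ₀.le hθ₁ ht
    _ = t ^ (α * θ - 1) * (M * |lam j ^ θ * v (unitEigenfunction lam φ j)|) := by
        rw [abs_mul, abs_of_nonneg (Real.rpow_nonneg (h.lam_pos j).le θ)]
        ring

theorem hasSum_solTerm (h : IsDiffusionData α αs b lam φ q v) (ht : 0 < t) :
    HasSum (solTerm α αs b lam φ v t)
      (dualSeries h.orthonormal (solCoords α αs b lam φ v t)) := by
  refine (hasSum_dualSeries h.orthonormal _).congr_fun fun j => ?_
  rw [solTerm, mul_smul, h.eigensystem.apply_smul_embed h.lam_pos, h.solCoords_apply ht, mul_smul]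

theorem solOp_eq (h : IsDiffusionData α αs b lam φ q v) (ht : 0 < t) :
    solOp α αs b lam φ v t = dualSeries h.orthonormal (solCoords α αs b lam φ v t) :=
  (h.hasSum_solTerm ht).tsum_eq

theorem solOp_apply (h : IsDiffusionData α αs b lam φ q v) (ht : 0 < t) (j : ℕ) :
    solOp α αs b lam φ v t (φ j) = modeFactor α αs b (lam j) t * v (φ j) := by
  rw [apply_eigenfunction h.lam_pos, h.solOp_eq ht, dualSeries_apply, h.solCoords_apply ht,
    apply_eigenfunction (φ := φ) h.lam_pos v, mul_left_comm]

theorem caputoDifferentiableAt_solOp (h : IsDiffusionData α αs b lam φ q v) (ht : 0 < t) {β : ℝ}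
    (hβ : β < 1) : CaputoDifferentiableAt β (solOp α αs b lam φ v) t := by
  obtain ⟨B, κ, hx⟩ := h.exists_hasRpowDominatedDeriv
  exact ((hx.caputoDifferentiableAt hβ ht).clm_comp (dualSeries h.orthonormal) ht.le).congr ht.le
    fun τ hτ => (h.solOp_eq hτ.1).symm

theorem multiTermDeriv_solOp (h : IsDiffusionData α αs b lam φ q v) (ht : 0 < t) :
    multiTermDeriv α αs b (solOp α αs b lam φ v) t
      = dualSeries h.orthonormal (multiTermDeriv α αs b (solCoords α αs b lam φ v) t) := by
  obtain ⟨B, κ, hx⟩ := h.exists_hasRpowDominatedDeriv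
  rw [multiTermDeriv_congr ht.le fun τ hτ => h.solOp_eq hτ.1]
  exact multiTermDeriv_clm_comp (hx.caputoDifferentiableAt h.orders.lt_one ht)
    (fun i => hx.caputoDifferentiableAt (h.orders.lower_lt_one i) ht) _ ht.le

theorem multiTermDeriv_solCoords_apply (h : IsDiffusionData α αs b lam φ q v) (ht : 0 < t)
    (j : ℕ) :
    multiTermDeriv α αs b (solCoords α αs b lam φ v) t j
      = -lam j * solCoords α αs b lam φ v t j := by
  obtain ⟨B, κ, hx⟩ := h.exists_hasRpowDominatedDeriv
  have hcongr : EqOn (fun τ => solCoords α αs b lam φ v τ j)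
      (fun τ => v (unitEigenfunction lam φ j) • modeFactor α αs b (lam j) τ) (Ioo 0 t) :=
    fun τ hτ => (h.solCoords_apply hτ.1 j).trans (mul_comm _ _)
  rw [hx.multiTermDeriv_coord h.orders.lt_one h.orders.lower_lt_one ht,
    multiTermDeriv_congr ht.le hcongr, multiTermDeriv_const_smul,
    eq_neg_of_add_eq_zero_left ((h.isRelaxation j).equation t ht), h.solCoords_apply ht,
    smul_eq_mul]
  ring

theorem multiTermDeriv_solOp_apply (h : IsDiffusionData α αs b lam φ q v) (ht : 0 < t) (j : ℕ) :
    multiTermDeriv α αs b (solOp α αs b lam φ v) t (φ j)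
      = -(lam j * modeFactor α αs b (lam j) t * v (φ j)) := by
  rw [apply_eigenfunction h.lam_pos, h.multiTermDeriv_solOp ht, dualSeries_apply,
    h.multiTermDeriv_solCoords_apply ht, h.solCoords_apply ht,
    apply_eigenfunction (φ := φ) h.lam_pos v]
  ring

theorem exists_embed_eq_solOp (h : IsDiffusionData α αs b lam φ q v) (ht : 0 < t) :
    ∃ w : H10 Ω, embed w = solOp α αs b lam φ v t ∧
      multiTermDeriv α αs b (solOp α αs b lam φ v) t - laplacian w = 0 := by
  set x := solCoords α αs b lam φ v t with hx
  set z := multiTermDeriv α αs b (solCoords α αs b lam φ v) t with hz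
  -- `(1 - Δ) w = u - P(∂ₜ) u`, and `1 - Δ` is the Riesz map of `H¹₀(Ω)`
  set w : H10 Ω := h.orthonormal.orthogonalFamily.linearIsometry (x - z)
  have hw : embed w = dualSeries h.orthonormal x := by
    refine apply_linearIsometry_eq_dualSeries h.orthonormal embed_apply_comm
      (h.eigensystem.embed_unitEigenfunction h.lam_pos) fun j => ?_
    have hpos : 0 < 1 + lam j := by linarith [h.lam_pos j]
    rw [lp.coeFn_sub, Pi.sub_apply, hz, h.multiTermDeriv_solCoords_apply ht, ← hx]
    field_simp
    ring
  have hriesz : dualSeries h.orthonormal (x - z) = embed w - laplacian w := toDual_H10 w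
  refine ⟨w, hw.trans (h.solOp_eq ht).symm, ?_⟩
  rw [map_sub, hw, sub_right_inj] at hriesz
  rw [h.multiTermDeriv_solOp ht, hriesz, sub_self]

theorem solvesHomogeneous (h : IsDiffusionData α αs b lam φ q v) (T : ℝ) :
    SolvesHomogeneous α αs b T (solOp α αs b lam φ v) := fun _ ht =>
  ⟨h.caputoDifferentiableAt_solOp ht.1 h.orders.lt_one,
    fun i => h.caputoDifferentiableAt_solOp ht.1 (h.orders.lower_lt_one i),
    h.exists_embed_eq_solOp ht.1⟩

variable {T p : ℝ}

theorem memDotH_solOp_and_norm_le (h : IsDiffusionData α αs b lam φ q v) (ht : t ∈ Ioc 0 T)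
    (hp₀ : 0 ≤ p - q) (hp₂ : p - q ≤ 2) :
    MemDotH lam φ p (solOp α αs b lam φ v t) ∧ dotHNorm lam φ p (solOp α αs b lam φ v t)
      ≤ relaxationDecayConst α αs b T * t ^ (-(α * ((p - q) / 2))) * dotHNorm lam φ q v := by
  have hC := (relaxationDecayConst_pos h.orders (ht.1.le.trans ht.2)).le
  refine memDotH_and_dotHNorm_le h.lam_pos (mul_nonneg hC (Real.rpow_nonneg ht.1.le _))
    h.memDotH fun j => ?_
  rw [h.solOp_apply ht.1, abs_mul, abs_of_nonneg (h.modeFactor_nonneg ht.1 j), ← mul_assoc]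
  exact mul_le_mul_of_nonneg_right ((h.isRelaxation j).rpow_mul_le h.orders (h.lam_pos j)
    (by linarith) (by linarith) ht) (abs_nonneg _)

theorem memDotH_multiTermDeriv_solOp_and_norm_le (h : IsDiffusionData α αs b lam φ q v)
    (ht : t ∈ Ioc 0 T) (hp₂ : -2 ≤ p - q) (hp₀ : p - q ≤ 0) :
    MemDotH lam φ p (multiTermDeriv α αs b (solOp α αs b lam φ v) t) ∧
      dotHNorm lam φ p (multiTermDeriv α αs b (solOp α αs b lam φ v) t)
        ≤ relaxationDecayConst α αs b T * t ^ (-(α * (1 + (p - q) / 2)))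
          * dotHNorm lam φ q v := by
  have hC := (relaxationDecayConst_pos h.orders (ht.1.le.trans ht.2)).le
  refine memDotH_and_dotHNorm_le h.lam_pos (mul_nonneg hC (Real.rpow_nonneg ht.1.le _))
    h.memDotH fun j => ?_
  rw [h.multiTermDeriv_solOp_apply ht.1, abs_neg, abs_mul,
    abs_of_nonneg (mul_nonneg (h.lam_pos j).le (h.modeFactor_nonneg ht.1 j)), ← mul_assoc,
    ← mul_assoc, ← Real.rpow_add_one (h.lam_pos j).ne', add_comm ((p - q) / 2) 1]
  exact mul_le_mul_of_nonneg_right ((h.isRelaxation j).rpow_mul_le h.orders (h.lam_pos j)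
    (by linarith) (by linarith) ht) (abs_nonneg _)

theorem solOp_sub_apply (h : IsDiffusionData α αs b lam φ q v) (ht : 0 < t) (j : ℕ) :
    (solOp α αs b lam φ v t - v) (φ j) = (modeFactor α αs b (lam j) t - 1) * v (φ j) := by
  rw [sub_one_mul, ← h.solOp_apply ht]
  rfl

theorem abs_solOp_sub_apply_le (h : IsDiffusionData α αs b lam φ q v) (ht : 0 < t) (j : ℕ) :
    |(solOp α αs b lam φ v t - v) (φ j)| ≤ |v (φ j)| := by
  rw [h.solOp_sub_apply ht, abs_mul]
  refine mul_le_of_le_one_left (abs_nonneg _) (abs_le.2 ⟨?_, ?_⟩)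
  · linarith [h.modeFactor_nonneg ht j]
  · linarith [h.modeFactor_le_one ht j]

theorem memDotH_solOp_sub (h : IsDiffusionData α αs b lam φ q v) (ht : 0 < t) :
    MemDotH lam φ q (solOp α αs b lam φ v t - v) :=
  (memDotH_and_dotHNorm_le h.lam_pos zero_le_one h.memDotH fun j => by
    simpa using h.abs_solOp_sub_apply_le ht j).1

theorem tendsto_dotHNorm_solOp_sub (h : IsDiffusionData α αs b lam φ q v) :
    Tendsto (fun t => dotHNorm lam φ q (solOp α αs b lam φ v t - v)) (𝓝[>] 0) (𝓝 0) := by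
  refine tendsto_dotHNorm_zero h.lam_pos h.memDotH
    (eventually_mem_nhdsWithin.mono fun t ht j => h.abs_solOp_sub_apply_le ht j) fun j => ?_
  have hinit : Tendsto (modeFactor α αs b (lam j)) (𝓝[>] 0) (𝓝 1) := by
    rw [← (h.isRelaxation j).apply_zero]
    exact ((h.isRelaxation j).regular.continuousOn 0 self_mem_Ici).mono_left
      (nhdsWithin_mono 0 Ioi_subset_Ici_self)
  have hzero : Tendsto (fun t => (modeFactor α αs b (lam j) t - 1) * v (φ j)) (𝓝[>] 0) (𝓝 0) := by
    simpa using (hinit.sub_const 1).mul_const (v (φ j))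
  exact hzero.congr' (eventually_mem_nhdsWithin.mono fun t ht => (h.solOp_sub_apply ht j).symm)

end IsDiffusionData

end Solution

end MultiTermDiffusion

open MultiTermDiffusion in
theorem theorem2p1_general (m : ℕ) (α : ℝ) (αs b : Fin m → ℝ) (T : ℝ)
    (hα₀ : 0 < α) (hα₁ : α < 1) (hαs : ∀ i, 0 < αs i ∧ αs i < α) (hb : ∀ i, 0 < b i)
    (hT : 0 < T) :
    ∃ C : ℝ, 0 < C ∧
      ∀ (d : ℕ), 1 ≤ d →
      ∀ (Ω : Set (EuclideanSpace ℝ (Fin d))), Bornology.IsBounded Ω →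
      ∀ (lam : ℕ → ℝ) (φ : ℕ → H10 Ω), IsDirichletEigensystem Ω lam φ →
      ∀ (q : ℝ), -1 < q →
      ∀ (v : HNegOne Ω), MemDotH lam φ q v →
      (∀ t ∈ Ioc 0 T, Summable (solTerm α αs b lam φ v t)) ∧
      SolvesHomogeneous α αs b T (solOp α αs b lam φ v) ∧
      (∀ p : ℝ, 0 ≤ p - q → p - q ≤ 2 → ∀ t ∈ Ioc 0 T,
        MemDotH lam φ p (solOp α αs b lam φ v t) ∧
        dotHNorm lam φ p (solOp α αs b lam φ v t)
          ≤ C * t ^ (-(α * ((p - q) / 2))) * dotHNorm lam φ q v) ∧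
      (∀ p : ℝ, -2 ≤ p - q → p - q ≤ 0 → ∀ t ∈ Ioc 0 T,
        MemDotH lam φ p (multiTermDeriv α αs b (solOp α αs b lam φ v) t) ∧
        dotHNorm lam φ p (multiTermDeriv α αs b (solOp α αs b lam φ v) t)
          ≤ C * t ^ (-(α * (1 + (p - q) / 2))) * dotHNorm lam φ q v) ∧
      (∀ t ∈ Ioc 0 T, MemDotH lam φ q (solOp α αs b lam φ v t - v)) ∧
      Tendsto (fun t => dotHNorm lam φ q (solOp α αs b lam φ v t - v))
        (𝓝[>] 0) (𝓝 0) := by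
  have hP : AdmissibleOrders α αs b :=
    ⟨hα₀, hα₁, fun i => (hαs i).1, fun i => (hαs i).2, hb⟩
  refine ⟨relaxationDecayConst α αs b T, relaxationDecayConst_pos hP hT.le,
    fun d hd Ω hΩ lam φ hsys q hq v hv => ?_⟩
  have h : IsDiffusionData α αs b lam φ q v :=
    ⟨hP, hsys, fun j => (hsys.eigenpair j).pos hd hΩ, hq, hv⟩
  exact ⟨fun t ht => (h.hasSum_solTerm ht.1).summable, h.solvesHomogeneous T,
    fun p hp₀ hp₂ t ht => h.memDotH_solOp_and_norm_le ht hp₀ hp₂,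
    fun p hp₂ hp₀ t ht => h.memDotH_multiTermDeriv_solOp_and_norm_le ht hp₂ hp₀,
    fun t ht => h.memDotH_solOp_sub ht.1, h.tendsto_dotHNorm_solOp_sub⟩

open MultiTermDiffusion in
theorem theorem2p1 (m : ℕ) (α : ℝ) (αs b : Fin m → ℝ) (T : ℝ)
    (hα₀ : 0 < α) (hα₁ : α < 1) (hαs : ∀ i, 0 < αs i ∧ αs i < α) (hb : ∀ i, 0 < b i)
    (hT : 0 < T) :
    ∃ C : ℝ, 0 < C ∧
      ∀ (d : ℕ), 1 ≤ d → d ≤ 3 →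
      ∀ (Ω : Set (EuclideanSpace ℝ (Fin d))), IsConvexPolygonalDomain Ω →
      ∀ (lam : ℕ → ℝ) (φ : ℕ → H10 Ω), IsDirichletEigensystem Ω lam φ →
      ∀ (q : ℝ), -1 < q → q ≤ 2 →
      ∀ (v : HNegOne Ω), MemDotH lam φ q v →
      -- the series for `E(t)v` converges in `H⁻¹(Ω)` and defines a solution
      (∀ t ∈ Set.Ioc 0 T, Summable (solTerm α αs b lam φ v t)) ∧
      SolvesHomogeneous α αs b T (solOp α αs b lam φ v) ∧
      -- the case `ℓ = 0`
      (∀ p : ℝ, 0 ≤ p - q → p - q ≤ 2 → ∀ t ∈ Set.Ioc 0 T,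
        MemDotH lam φ p (solOp α αs b lam φ v t) ∧
        dotHNorm lam φ p (solOp α αs b lam φ v t)
          ≤ C * t ^ (-(α * ((p - q) / 2))) * dotHNorm lam φ q v) ∧
      -- the case `ℓ = 1`
      (∀ p : ℝ, -2 ≤ p - q → p - q ≤ 0 → ∀ t ∈ Set.Ioc 0 T,
        MemDotH lam φ p (multiTermDeriv α αs b (solOp α αs b lam φ v) t) ∧
        dotHNorm lam φ p (multiTermDeriv α αs b (solOp α αs b lam φ v) t)
          ≤ C * t ^ (-(α * (1 + (p - q) / 2))) * dotHNorm lam φ q v) ∧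
      -- the initial condition
      (∀ t ∈ Set.Ioc 0 T, MemDotH lam φ q (solOp α αs b lam φ v t - v)) ∧
      Filter.Tendsto (fun t => dotHNorm lam φ q (solOp α αs b lam φ v t - v))
        (nhdsWithin 0 (Set.Ioi 0)) (nhds 0) := by
  obtain ⟨C, hC, h⟩ := theorem2p1_general m α αs b T hα₀ hα₁ hαs hb hT
  exact ⟨C, hC, fun d hd _ Ω hΩ lam φ hsys q hq _ => h d hd Ω hΩ.isBounded lam φ hsys q hq⟩
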